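/- Let $(\bar M,g,J)$ be a nearly Kaehler manifold: a finite-dimensional smooth Riemannian manifold with a smooth almost complex structure $J$ satisfying $J^2=-I$, $g(JX,JY)=g(X,Y)$ and $(\bar\nabla_XJ)X=0$ for all vector fields $X$, where $\bar\nabla$ is the Levi-Civita connection of $g$. Let $(N_T,g_1)$ and $(N_\theta,g_2)$ be finite-dimensional smooth Riemannian manifolds, $f$ a positive smooth function on $N_T$, and $M=N_T\times_fN_\theta$ their warped product, i.e. the manifold $N_T\times N_\theta$ with the metric $g_1+f^2g_2$ (pulled back along the projections). Let $\varphi:M\to\bar M$ be a smooth isometric immersion such that - each $\varphi(N_T\times\{q\})$ is a holomorphic submanifold: $J$ maps its tangent spaces onto themselves; - each $\varphi(\{p\}\times N_\theta)$ is a proper slant submanifold with the same slant angle $\theta$: for every nonzero tangent vector $Z$ the angle between $JZ$ and the tangent space equals $\theta$, and the submanifold is neither holomorphic nor totally real (totally real means that $J$ maps tangent vectors to normal vectors). Let $\dim N_\theta=2\beta$, let $h$ be the second fundamental form of $M$ in $\bar M$, and $\|h\|^2=\sum_{i,j}g(h(e_i,e_j),h(e_i,e_j))$ for an orthonormal basis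 $(e_i)$ of the tangent space of $M$. Let $\mathrm{grad}\ln f$ be the gradient on $M$ of the function $(p,q)\mapsto\ln f(p)$. **Theorem 4.1.** (i) At every point of $M$, $$\|h\|^2\ \ge\ 4\beta\Big(\csc^2\theta+\tfrac19\cot^2\theta\Big)\,\|\mathrm{grad}\ln f\|^2 .$$ (ii) If equality holds at every point of $M$, then every $N_T\times\{q\}$ is totally geodesic in $\bar M$ (its second fundamental form in $\bar M$ vanishes), every $\{p\}\times N_\theta$ is totally umbilical in $\bar M$ (its second fundamental form in $\bar M$ is the induced metric times its mean curvature vector, the mean curvature vector being the trace of the second fundamental form divided by the dimension), and $M$ is a minimal submanifold of $\bar M$ (its mean curvature vector vanishes). -/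

import Mathlib

open Bundle Manifold
open scoped ContDiff RealInnerProductSpace

noncomputable section

namespace WarpedSemiSlant

/-- Tangent spaces of a finite-dimensional manifold are finite-dimensional. -/
instance instFiniteDimensionalTangent {E : Type*} [NormedAddCommGroup E] [NormedSpace ℝ E]
    [FiniteDimensional ℝ E] {H : Type*} [TopologicalSpace H] {I : ModelWithCorners ℝ E H}
    {M : Type*} [TopologicalSpace M] [ChartedSpace H M] (x : M) :
    FiniteDimensional ℝ (TangentSpace I x) :=
  inferInstanceAs (FiniteDimensional ℝ E)

/-! ### The ambient manifold: Levi-Civita connection, nearly Kaehler structures -/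

section Ambient

variable {E : Type*} [NormedAddCommGroup E] [NormedSpace ℝ E] [FiniteDimensional ℝ E]
  {H : Type*} [TopologicalSpace H] {I : ModelWithCorners ℝ E H}
  {N : Type*} [TopologicalSpace N] [ChartedSpace H N] [IsManifold I ∞ N]
  [RiemannianBundle (fun y : N ↦ TangentSpace I y)]
  [IsContMDiffRiemannianBundle I ∞ E (fun y : N ↦ TangentSpace I y)]

/-- The right-hand side of the Koszul formula for `2 ⟪∇_X Y, Z⟫` at `y`. -/
def koszul (X Y Z : ∀ y : N, TangentSpace I y) (y : N) : ℝ :=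
  mvfderiv I (fun z ↦ ⟪Y z, Z z⟫) y (X y)
    + mvfderiv I (fun z ↦ ⟪X z, Z z⟫) y (Y y)
    - mvfderiv I (fun z ↦ ⟪X z, Y z⟫) y (Z y)
    + ⟪VectorField.mlieBracket I X Y y, Z y⟫
    - ⟪VectorField.mlieBracket I X Z y, Y y⟫
    - ⟪VectorField.mlieBracket I Y Z y, X y⟫

/-- The Levi-Civita connection of `N`: `leviCivita Y y u` is `∇_u Y` at `y`, for a vector field `Y`
differentiable at `y`. It is the vector with `⟪∇_u Y, e⟫ = koszul u Y e / 2` for all vectors `e`,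
written out in an orthonormal basis `e_i` of the tangent space. As the Koszul expression at `y` is
tensorial in `X` and `Z`, the vectors `u` and `e_i` may be extended to vector fields at will. -/
def leviCivita (Y : ∀ y : N, TangentSpace I y) (y : N) (u : TangentSpace I y) : TangentSpace I y :=
  ∑ i, (koszul (FiberBundle.extend E u) Y
      (FiberBundle.extend E (stdOrthonormalBasis ℝ (TangentSpace I y) i)) y / 2) •
    stdOrthonormalBasis ℝ (TangentSpace I y) i

/-- `J` is a smooth almost complex structure for which the metric is Hermitian. -/
structure IsAlmostHermitian (J : ∀ y : N, TangentSpace I y →L[ℝ] TangentSpace I y) : Prop where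
  contMDiff : ContMDiff I (I.prod 𝓘(ℝ, E →L[ℝ] E)) ∞
    (fun y ↦ TotalSpace.mk' (E →L[ℝ] E)
      (E := fun y : N ↦ TangentSpace I y →L[ℝ] TangentSpace I y) y (J y))
  sq : ∀ (y : N) (u : TangentSpace I y), J y (J y u) = -u
  inner_map_map : ∀ (y : N) (u v : TangentSpace I y), ⟪J y u, J y v⟫ = ⟪u, v⟫

/-- `(N, J)` is nearly Kaehler: it is almost Hermitian and `(∇_X J) X = ∇_X (J X) - J (∇_X X)`
vanishes for all vector fields `X` differentiable at the point considered. -/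
structure IsNearlyKaehler (J : ∀ y : N, TangentSpace I y →L[ℝ] TangentSpace I y) : Prop
    extends IsAlmostHermitian J where
  nabla_self : ∀ (X : ∀ y : N, TangentSpace I y) (y : N),
    MDifferentiableAt I (I.prod 𝓘(ℝ, E)) (fun z ↦ TotalSpace.mk' E z (X z)) y →
      leviCivita (fun z ↦ J z (X z)) y (X y) - J y (leviCivita X y (X y)) = 0

end Ambient

/-! ### Gradient on a Riemannian manifold -/

section Gradient

variable {E : Type*} [NormedAddCommGroup E] [NormedSpace ℝ E] [FiniteDimensional ℝ E]
  {H : Type*} [TopologicalSpace H] (I : ModelWithCorners ℝ E H)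
  {M : Type*} [TopologicalSpace M] [ChartedSpace H M]
  [RiemannianBundle (fun x : M ↦ TangentSpace I x)]

/-- The gradient of `ψ` at `x`: the vector with `⟪grad ψ, X⟫ = X ψ` for all `X`. -/
def grad (ψ : M → ℝ) (x : M) : TangentSpace I x :=
  (InnerProductSpace.toDual ℝ (TangentSpace I x)).symm (mvfderiv I ψ x)

end Gradient

/-! ### Immersed submanifolds

Throughout this section `φ : M → N` is to be thought of as an immersion, and `M` carries the metric
induced by `φ`; a tangent vector `u` of `M` is identified with the vector `dφ u` of `N`. -/

section Submanifold

variable {E' : Type*} [NormedAddCommGroup E'] [NormedSpace ℝ E']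
  {H' : Type*} [TopologicalSpace H'] (I' : ModelWithCorners ℝ E' H')
  {M : Type*} [TopologicalSpace M] [ChartedSpace H' M] [IsManifold I' ∞ M]
  {E : Type*} [NormedAddCommGroup E] [NormedSpace ℝ E] [FiniteDimensional ℝ E]
  {H : Type*} [TopologicalSpace H] (I : ModelWithCorners ℝ E H)
  {N : Type*} [TopologicalSpace N] [ChartedSpace H N] [IsManifold I ∞ N]
  [RiemannianBundle (fun y : N ↦ TangentSpace I y)]

/-- The tangent space of the submanifold at `x`, as a subspace of the ambient tangent space. -/
def tangentImage (φ : M → N) (x : M) : Submodule ℝ (TangentSpace I (φ x)) :=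
  LinearMap.range (mfderiv I' I φ x).toLinearMap

/-- The component of an ambient vector that is tangent to the submanifold. -/
def tangentPart (φ : M → N) (x : M) (w : TangentSpace I (φ x)) : TangentSpace I (φ x) :=
  (tangentImage I' I φ x).starProjection w

/-- The component of an ambient vector that is normal to the submanifold. -/
def normalPart (φ : M → N) (x : M) (w : TangentSpace I (φ x)) : TangentSpace I (φ x) :=
  w - tangentPart I' I φ x w

/-- The covariant derivative `∇_u W` at `x` of a vector field `W` along `φ` (the pulled back
connection). In the local frame `E_i` of `TN` given by the trivialization around `φ x`, write
`W = ∑ W^i (E_i ∘ φ)`; then `∇_u W = ∑ (u W^i) E_i + ∑ W^i ∇_{dφ u} E_i`. The section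
`FiberBundle.extend E w` is the one with constant components in this frame and value `w` at
`φ x`. -/
def covAlong (φ : M → N)
    (W : ∀ x : M, TangentSpace I (φ x)) (x : M) (u : TangentSpace I' x) : TangentSpace I (φ x) :=
  letI t := trivializationAt E (fun y : N ↦ TangentSpace I y) (φ x)
  t.symm (φ x) (mvfderiv I' (fun x' ↦ (t ⟨φ x', W x'⟩).2) x u)
    + leviCivita (FiberBundle.extend E (W x)) (φ x) (mfderiv I' I φ x u)

/-- The second fundamental form `h(u, v)` at `x`: the normal part of the ambient derivative
`∇_u (dφ V)`, where `V` is a vector field on `M` around `x` with `V x = v`. -/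
def secondFundamentalForm (φ : M → N) (x : M) (u v : TangentSpace I' x) : TangentSpace I (φ x) :=
  normalPart I' I φ x
    (covAlong I' I φ (fun x' ↦ mfderiv I' I φ x' (FiberBundle.extend E' v x')) x u)

/-- A basis of the tangent space of the submanifold at `x`, orthonormal for the induced metric:
the vectors `e i` tangent to `M` whose images `dφ (e i)` are a fixed orthonormal basis of the
tangent space inside the ambient one. (When `φ` is an immersion, `e i` is determined by its
image.) -/
def inducedFrame (φ : M → N) (x : M)
    (i : Fin (Module.finrank ℝ (tangentImage I' I φ x))) : TangentSpace I' x :=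
  Classical.choose (LinearMap.mem_range.1
    (stdOrthonormalBasis ℝ (tangentImage I' I φ x) i).2)

/-- The squared norm of the second fundamental form, `‖h‖² = ∑_{i,j} ‖h(e_i, e_j)‖²`. -/
def sqNormSecondFundamentalForm (φ : M → N) (x : M) : ℝ :=
  ∑ i, ∑ j, ⟪secondFundamentalForm I' I φ x (inducedFrame I' I φ x i)
      (inducedFrame I' I φ x j),
    secondFundamentalForm I' I φ x (inducedFrame I' I φ x i) (inducedFrame I' I φ x j)⟫

/-- The mean curvature vector `H = (1/n) ∑_i h(e_i, e_i)`. -/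
def meanCurvature (φ : M → N) (x : M) : TangentSpace I (φ x) :=
  (1 / (Module.finrank ℝ (tangentImage I' I φ x) : ℝ)) •
    ∑ i, secondFundamentalForm I' I φ x (inducedFrame I' I φ x i) (inducedFrame I' I φ x i)

/-- Totally geodesic: `h = 0`. -/
def IsTotallyGeodesic (φ : M → N) : Prop :=
  ∀ (x : M) (u v : TangentSpace I' x), secondFundamentalForm I' I φ x u v = 0

/-- Totally umbilical: `h(u, v) = g(u, v) H`, with `g` the induced metric and `H` the mean
curvature vector. -/
def IsTotallyUmbilical (φ : M → N) : Prop :=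
  ∀ (x : M) (u v : TangentSpace I' x), secondFundamentalForm I' I φ x u v =
    ⟪mfderiv I' I φ x u, mfderiv I' I φ x v⟫ • meanCurvature I' I φ x

/-- Minimal: `H = 0`. -/
def IsMinimal (φ : M → N) : Prop :=
  ∀ x : M, meanCurvature I' I φ x = 0

/-- Holomorphic submanifold: `J (T_x M) = T_x M` for all `x`. -/
def IsHolomorphic (J : ∀ y : N, TangentSpace I y →L[ℝ] TangentSpace I y) (φ : M → N) : Prop :=
  ∀ x : M, (tangentImage I' I φ x).map (J (φ x)).toLinearMap = tangentImage I' I φ x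

/-- Totally real submanifold: `J (T_x M) ⊆ T_x^⊥ M` for all `x`. -/
def IsTotallyReal (J : ∀ y : N, TangentSpace I y →L[ℝ] TangentSpace I y) (φ : M → N) : Prop :=
  ∀ x : M, (tangentImage I' I φ x).map (J (φ x)).toLinearMap ≤ (tangentImage I' I φ x)ᗮ

/-- The Wirtinger angle of the tangent vector `u`: the angle between `J u` and the tangent space
of the submanifold, i.e. between `J u` and its tangential part (it is `π / 2` if that part
vanishes). -/
def wirtingerAngle (J : ∀ y : N, TangentSpace I y →L[ℝ] TangentSpace I y) (φ : M → N) (x : M)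
    (u : TangentSpace I' x) : ℝ :=
  InnerProductGeometry.angle (J (φ x) (mfderiv I' I φ x u))
    (tangentPart I' I φ x (J (φ x) (mfderiv I' I φ x u)))

/-- Slant submanifold with slant angle `θ`: all nonzero tangent vectors have Wirtinger
angle `θ`. -/
def IsSlant (J : ∀ y : N, TangentSpace I y →L[ℝ] TangentSpace I y) (φ : M → N) (θ : ℝ) : Prop :=
  ∀ (x : M) (u : TangentSpace I' x), u ≠ 0 → wirtingerAngle I' I J φ x u = θ

/-- Proper slant submanifold with slant angle `θ`: slant, neither holomorphic nor totally real. -/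
def IsProperSlant (J : ∀ y : N, TangentSpace I y →L[ℝ] TangentSpace I y) (φ : M → N) (θ : ℝ) :
    Prop :=
  IsSlant I' I J φ θ ∧ ¬ IsHolomorphic I' I J φ ∧ ¬ IsTotallyReal I' I J φ

/-- `φ` is a smooth isometric immersion of the Riemannian manifold `M` into `N`. -/
structure IsIsometricImmersion [RiemannianBundle (fun x : M ↦ TangentSpace I' x)] (φ : M → N) :
    Prop where
  contMDiff : ContMDiff I' I ∞ φ
  inner_mfderiv : ∀ (x : M) (u v : TangentSpace I' x),
    ⟪mfderiv I' I φ x u, mfderiv I' I φ x v⟫ = ⟪u, v⟫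

end Submanifold

/-! ### Warped products -/

section Warped

variable {E₁ : Type*} [NormedAddCommGroup E₁] [NormedSpace ℝ E₁]
  {H₁ : Type*} [TopologicalSpace H₁] (I₁ : ModelWithCorners ℝ E₁ H₁)
  {N₁ : Type*} [TopologicalSpace N₁] [ChartedSpace H₁ N₁]
  [RiemannianBundle (fun p : N₁ ↦ TangentSpace I₁ p)]
  {E₂ : Type*} [NormedAddCommGroup E₂] [NormedSpace ℝ E₂]
  {H₂ : Type*} [TopologicalSpace H₂] (I₂ : ModelWithCorners ℝ E₂ H₂)
  {N₂ : Type*} [TopologicalSpace N₂] [ChartedSpace H₂ N₂]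
  [RiemannianBundle (fun q : N₂ ↦ TangentSpace I₂ q)]

/-- The Riemannian metric carried by the product manifold `N₁ × N₂` is the warped product metric
`g = g₁ + f² g₂` with warping function `f`, a positive smooth function on `N₁`. -/
structure IsWarpedProduct [RiemannianBundle (fun x : N₁ × N₂ ↦ TangentSpace (I₁.prod I₂) x)]
    (f : N₁ → ℝ) : Prop where
  contMDiff : ContMDiff I₁ 𝓘(ℝ, ℝ) ∞ f
  pos : ∀ p, 0 < f p
  inner_eq : ∀ (x : N₁ × N₂) (u v : TangentSpace (I₁.prod I₂) x),
    ⟪u, v⟫ =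
      ⟪(mfderiv (I₁.prod I₂) I₁ Prod.fst x u : TangentSpace I₁ x.1),
        mfderiv (I₁.prod I₂) I₁ Prod.fst x v⟫
      + f x.1 ^ 2 *
      ⟪(mfderiv (I₁.prod I₂) I₂ Prod.snd x u : TangentSpace I₂ x.2),
        mfderiv (I₁.prod I₂) I₂ Prod.snd x v⟫

end Warped

end WarpedSemiSlant

end

noncomputable section

namespace WarpedSemiSlant

open Set Filter Topology

set_option linter.unusedSectionVars false

section Coordinates

variable {E : Type*} [NormedAddCommGroup E] [NormedSpace ℝ E]
  {H : Type*} [TopologicalSpace H] {I : ModelWithCorners ℝ E H}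
  {M : Type*} [TopologicalSpace M] [ChartedSpace H M] [IsManifold I ∞ M]

variable (I) in
/-- The components of tangent vectors at `x` in the chart around `x₀`. -/
def comps (x₀ x : M) : TangentSpace I x →L[ℝ] E :=
  (trivializationAt E (fun y : M ↦ TangentSpace I y) x₀).continuousLinearMapAt ℝ x

variable (I) in
/-- The tangent vector at `x` with given components in the chart around `x₀`. -/
def ofComps (x₀ x : M) : E →L[ℝ] TangentSpace I x :=
  (trivializationAt E (fun y : M ↦ TangentSpace I y) x₀).symmL ℝ x

theorem trivializationAt_snd {x₀ x : M} (hx : x ∈ (chartAt H x₀).source)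
    (v : TangentSpace I x) :
    (trivializationAt E (fun y : M ↦ TangentSpace I y) x₀ ⟨x, v⟩).2 = comps I x₀ x v := by
  rw [comps, Bundle.Trivialization.continuousLinearMapAt_apply,
    Bundle.Trivialization.coe_linearMapAt_of_mem _ (by exact hx)]

theorem comps_eq_mfderiv {x₀ x : M} (hx : x ∈ (chartAt H x₀).source)
    (v : TangentSpace I x) :
    comps I x₀ x v = mfderiv I 𝓘(ℝ, E) (extChartAt I x₀) x v := by
  rw [comps, TangentBundle.continuousLinearMapAt_trivializationAt hx]
  rfl

theorem comps_ofComps {x₀ x : M} (hx : x ∈ (chartAt H x₀).source) (a : E) :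
    comps I x₀ x (ofComps I x₀ x a) = a :=
  (trivializationAt E (fun y : M ↦ TangentSpace I y) x₀).continuousLinearMapAt_symmL (R := ℝ)
    (by exact hx) a

theorem ofComps_comps {x₀ x : M} (hx : x ∈ (chartAt H x₀).source) (v : TangentSpace I x) :
    ofComps I x₀ x (comps I x₀ x v) = v :=
  (trivializationAt E (fun y : M ↦ TangentSpace I y) x₀).symmL_continuousLinearMapAt (R := ℝ)
    (by exact hx) v

theorem extend_eq_ofComps {x₀ : M} (v : TangentSpace I x₀) {x : M}
    (hx : x ∈ (chartAt H x₀).source) :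
    FiberBundle.extend E v x = ofComps I x₀ x (comps I x₀ x₀ v) := by
  rw [← trivializationAt_snd (mem_chart_source H x₀)]
  exact ((trivializationAt E (fun y : M ↦ TangentSpace I y) x₀).symmL_apply (R := ℝ)
    (by exact hx) _).symm

theorem comps_extend {x₀ x : M} (hx : x ∈ (chartAt H x₀).source) (v : TangentSpace I x₀) :
    comps I x₀ x (FiberBundle.extend E v x) = comps I x₀ x₀ v := by
  rw [extend_eq_ofComps v hx, comps_ofComps hx]

theorem comps_injective {x₀ x : M} (hx : x ∈ (chartAt H x₀).source) {v w : TangentSpace I x}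
    (h : comps I x₀ x v = comps I x₀ x w) : v = w := by
  rw [← ofComps_comps hx v, h, ofComps_comps hx w]

theorem eventually_mem_chart_source (x₀ : M) : ∀ᶠ x in 𝓝 x₀, x ∈ (chartAt H x₀).source :=
  (chartAt H x₀).open_source.mem_nhds (mem_chart_source H x₀)

theorem mdifferentiableAt_section_iff_comps {X : ∀ x : M, TangentSpace I x} {x₀ : M} :
    MDifferentiableAt I (I.prod 𝓘(ℝ, E)) (fun x ↦ TotalSpace.mk' E x (X x)) x₀ ↔
      MDifferentiableAt I 𝓘(ℝ, E) (fun x ↦ comps I x₀ x (X x)) x₀ := by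
  rw [mdifferentiableAt_section]
  refine Filter.EventuallyEq.mdifferentiableAt_iff ?_
  filter_upwards [eventually_mem_chart_source (H := H) x₀] with x hx
  exact trivializationAt_snd hx (X x)

end Coordinates

section Metric

variable {E : Type*} [NormedAddCommGroup E] [NormedSpace ℝ E]
  {H : Type*} [TopologicalSpace H] {I : ModelWithCorners ℝ E H}
  {N : Type*} [TopologicalSpace N] [ChartedSpace H N] [IsManifold I ∞ N]

variable (I) in
/-- `G` is the Gram form of the metric in the chart around `y₀`. -/
structure IsLocalMetric [RiemannianBundle (fun y : N ↦ TangentSpace I y)]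
    (y₀ : N) (G : N → E →L[ℝ] E →L[ℝ] ℝ) : Prop where
  mdifferentiableAt : MDifferentiableAt I 𝓘(ℝ, E →L[ℝ] E →L[ℝ] ℝ) G y₀
  inner_eq : ∀ y ∈ (chartAt H y₀).source, ∀ v w : TangentSpace I y,
    ⟪v, w⟫ = G y (comps I y₀ y v) (comps I y₀ y w)

theorem exists_isLocalMetric [RiemannianBundle (fun y : N ↦ TangentSpace I y)]
    [IsContMDiffRiemannianBundle I ∞ E (fun y : N ↦ TangentSpace I y)] (y₀ : N) :
    ∃ G : N → E →L[ℝ] E →L[ℝ] ℝ, IsLocalMetric I y₀ G := by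
  obtain ⟨g, hg, hgi⟩ := IsContMDiffRiemannianBundle.exists_contMDiff (IB := I) (n := ∞) (F := E)
    (E := fun y : N ↦ TangentSpace I y)
  have h := (contMDiffAt_hom_bundle _).1 (hg y₀)
  refine ⟨_, h.2.mdifferentiableAt (by simp), fun y hy v w ↦ ?_⟩
  rw [hgi]
  refine Eq.trans ?_ (inCoordinates_apply_eq₂ (F₁ := E) (F₂ := E) (F₃ := ℝ)
    (E₁ := fun y : N ↦ TangentSpace I y) (E₂ := fun y : N ↦ TangentSpace I y)
    (E₃ := Bundle.Trivial N ℝ) (x₀ := y₀) (x := y) (by exact hy) (by exact hy)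
    (Set.mem_univ _)).symm
  have h1 : ∀ v : TangentSpace I y,
      (trivializationAt E (fun y : N ↦ TangentSpace I y) y₀).symm y (comps I y₀ y v) = v :=
    fun v ↦ ((trivializationAt E (fun y : N ↦ TangentSpace I y) y₀).symmL_apply (R := ℝ)
      (by exact hy) _).symm.trans (ofComps_comps hy v)
  rw [h1, h1]
  simp

theorem exists_local_endomorphism
    (J : ∀ y : N, TangentSpace I y →L[ℝ] TangentSpace I y)
    (hJ : ContMDiff I (I.prod 𝓘(ℝ, E →L[ℝ] E)) ∞
      (fun y ↦ TotalSpace.mk' (E →L[ℝ] E)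
        (E := fun y : N ↦ TangentSpace I y →L[ℝ] TangentSpace I y) y (J y))) (y₀ : N) :
    ∃ A : N → E →L[ℝ] E, MDifferentiableAt I 𝓘(ℝ, E →L[ℝ] E) A y₀ ∧
      ∀ y ∈ (chartAt H y₀).source, ∀ v : TangentSpace I y,
        comps I y₀ y (J y v) = A y (comps I y₀ y v) := by
  have h := (contMDiffAt_hom_bundle _).1 (hJ y₀)
  refine ⟨_, h.2.mdifferentiableAt (by simp), fun y hy v ↦ ?_⟩
  have h1 := ofComps_comps hy v
  unfold ContinuousLinearMap.inCoordinates
  change _ = comps I y₀ y (J y (ofComps I y₀ y (comps I y₀ y v)))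
  rw [h1]

end Metric

section Bracket

variable {E : Type*} [NormedAddCommGroup E] [NormedSpace ℝ E]
  {H : Type*} [TopologicalSpace H] {I : ModelWithCorners ℝ E H}
  {N : Type*} [TopologicalSpace N] [ChartedSpace H N] [IsManifold I ∞ N]
  {V : Type*} [NormedAddCommGroup V] [NormedSpace ℝ V]

omit [IsManifold I ∞ N] in
theorem mvfderiv_congr {F G : N → V} {x : N} (h : F =ᶠ[𝓝 x] G) :
    mvfderiv I F x = mvfderiv I G x := by
  ext v
  unfold mvfderiv
  rw [h.mfderiv_eq]
  rfl

theorem mvfderiv_comp_extChartAt {K : E → V} {x₀ x : N} (hx : x ∈ (chartAt H x₀).source)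
    (hK : DifferentiableAt ℝ K (extChartAt I x₀ x)) (w : TangentSpace I x) :
    mvfderiv I (fun x ↦ K (extChartAt I x₀ x)) x w =
      fderiv ℝ K (extChartAt I x₀ x) (comps I x₀ x w) := by
  have h := (hK.hasFDerivAt.hasMFDerivAt).comp x (hasMFDerivAt_extChartAt (I := I) hx)
  rw [comps_eq_mfderiv hx]
  have h2 := (hasMFDerivAt_extChartAt (I := I) hx).mfderiv
  rw [h2]
  change mfderiv I 𝓘(ℝ, V) (K ∘ extChartAt I x₀) x w = _
  rw [h.mfderiv]
  rfl

theorem differentiableAt_comp_extChartAt_symm [I.Boundaryless] {F : N → V} {x₀ : N}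
    (hF : MDifferentiableAt I 𝓘(ℝ, V) F x₀) :
    DifferentiableAt ℝ (F ∘ (extChartAt I x₀).symm) (extChartAt I x₀ x₀) := by
  have h := (mdifferentiableAt_iff_source_of_mem_source (mem_chart_source H x₀)).1 hF
  rwa [I.range_eq_univ, mdifferentiableWithinAt_univ, mdifferentiableAt_iff_differentiableAt] at h

theorem mvfderiv_eq_fderiv [I.Boundaryless] {F : N → V} {x₀ : N}
    (hF : MDifferentiableAt I 𝓘(ℝ, V) F x₀) (w : TangentSpace I x₀) :
    mvfderiv I F x₀ w =
      fderiv ℝ (F ∘ (extChartAt I x₀).symm) (extChartAt I x₀ x₀) (comps I x₀ x₀ w) := by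
  rw [← mvfderiv_comp_extChartAt (mem_chart_source H x₀) (differentiableAt_comp_extChartAt_symm hF)]
  congr 1
  refine mvfderiv_congr ?_
  filter_upwards [eventually_mem_chart_source (H := H) x₀] with x hx
  rw [Function.comp_apply, (extChartAt I x₀).left_inv (by rwa [extChartAt_source])]

theorem mpullbackWithin_extChartAt_symm {y₀ : N} {z : E} (hz : z ∈ (extChartAt I y₀).target)
    (V : ∀ y : N, TangentSpace I y) :
    VectorField.mpullbackWithin 𝓘(ℝ, E) I (extChartAt I y₀).symm V (range I) z =
      comps I y₀ ((extChartAt I y₀).symm z) (V ((extChartAt I y₀).symm z)) := by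
  have hy : (extChartAt I y₀).symm z ∈ (chartAt H y₀).source := by
    rw [← extChartAt_source I]; exact (extChartAt I y₀).map_target hz
  rw [VectorField.mpullbackWithin_apply, comps_eq_mfderiv hy]
  have h2 := ContinuousLinearMap.inverse_eq
    (mfderivWithin_extChartAt_symm_comp_mfderiv_extChartAt hz)
    (mfderiv_extChartAt_comp_mfderivWithin_extChartAt_symm hz)
  exact congrArg (fun L ↦ L (V ((extChartAt I y₀).symm z))) h2

theorem comps_mlieBracket [I.Boundaryless] {X Y : ∀ y : N, TangentSpace I y} {y₀ : N}
    (hX : MDifferentiableAt I 𝓘(ℝ, E) (fun y ↦ comps I y₀ y (X y)) y₀)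
    (hY : MDifferentiableAt I 𝓘(ℝ, E) (fun y ↦ comps I y₀ y (Y y)) y₀) :
    comps I y₀ y₀ (VectorField.mlieBracket I X Y y₀) =
      mvfderiv I (fun y ↦ comps I y₀ y (Y y)) y₀ (X y₀)
        - mvfderiv I (fun y ↦ comps I y₀ y (X y)) y₀ (Y y₀) := by
  have key : ∀ V : ∀ y : N, TangentSpace I y,
      VectorField.mpullbackWithin 𝓘(ℝ, E) I (extChartAt I y₀).symm V (range I)
        =ᶠ[𝓝 (extChartAt I y₀ y₀)]
        (fun y ↦ comps I y₀ y (V y)) ∘ (extChartAt I y₀).symm := by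
    intro V
    filter_upwards [extChartAt_target_mem_nhds (I := I) y₀] with z hz
    exact mpullbackWithin_extChartAt_symm hz V
  have hd : ∀ V W : ∀ y : N, TangentSpace I y,
      MDifferentiableAt I 𝓘(ℝ, E) (fun y ↦ comps I y₀ y (V y)) y₀ → 
      fderiv ℝ (VectorField.mpullbackWithin 𝓘(ℝ, E) I (extChartAt I y₀).symm V (range I))
        (extChartAt I y₀ y₀)
        (VectorField.mpullbackWithin 𝓘(ℝ, E) I (extChartAt I y₀).symm W (range I)
          (extChartAt I y₀ y₀)) =
      mvfderiv I (fun y ↦ comps I y₀ y (V y)) y₀ (W y₀) := by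
    intro V W hV
    rw [mvfderiv_eq_fderiv hV, ← (key V).fderiv_eq, (key W).eq_of_nhds, Function.comp_apply,
      extChartAt_to_inv]
  rw [comps_eq_mfderiv (mem_chart_source H y₀), ← VectorField.mlieBracketWithin_univ,
    VectorField.mlieBracketWithin_apply, preimage_univ, univ_inter]
  refine ((isInvertible_mfderiv_extChartAt (mem_extChartAt_source (I := I) y₀)).self_apply_inverse
    _).trans ?_
  rw [← hd X Y hX, ← hd Y X hY]
  have hl : ∀ U V : E → E, VectorField.lieBracketWithin ℝ U V (range I) (extChartAt I y₀ y₀) =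
      fderiv ℝ V (extChartAt I y₀ y₀) (U (extChartAt I y₀ y₀))
        - fderiv ℝ U (extChartAt I y₀ y₀) (V (extChartAt I y₀ y₀)) := by
    intro U V
    rw [I.range_eq_univ, VectorField.lieBracketWithin_univ]
    rfl
  exact hl _ _

end Bracket

section AlongMap

variable {E' : Type*} [NormedAddCommGroup E'] [NormedSpace ℝ E']
  {H' : Type*} [TopologicalSpace H'] {I' : ModelWithCorners ℝ E' H'}
  {M : Type*} [TopologicalSpace M] [ChartedSpace H' M] [IsManifold I' ∞ M]
  {E : Type*} [NormedAddCommGroup E] [NormedSpace ℝ E]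
  {H : Type*} [TopologicalSpace H] {I : ModelWithCorners ℝ E H}
  {N : Type*} [TopologicalSpace N] [ChartedSpace H N] [IsManifold I ∞ N]

theorem eventually_apply_mem_chart_source {φ : M → N} {x₀ : M}
    (hφ : MDifferentiableAt I' I φ x₀) : ∀ᶠ x in 𝓝 x₀, φ x ∈ (chartAt H (φ x₀)).source :=
  hφ.continuousAt.eventually (eventually_mem_chart_source (H := H) (φ x₀))

variable (I' I) in
/-- The vector field `W` along `φ` is differentiable at `x₀`. -/
def DiffAlong (φ : M → N) (W : ∀ x : M, TangentSpace I (φ x)) (x₀ : M) : Prop :=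
  MDifferentiableAt I' 𝓘(ℝ, E) (fun x ↦ comps I (φ x₀) (φ x) (W x)) x₀

variable (I' I) in
/-- The derivative of the components of the vector field `W` along `φ`. -/
def derivComps (φ : M → N) (W : ∀ x : M, TangentSpace I (φ x)) (x₀ : M) :
    TangentSpace I' x₀ →L[ℝ] E :=
  mvfderiv I' (fun x ↦ comps I (φ x₀) (φ x) (W x)) x₀

theorem mvfderiv_comp_vec {V : Type*} [NormedAddCommGroup V] [NormedSpace ℝ V]
    {φ : M → N} {x₀ : M} {G : N → V} (hG : MDifferentiableAt I 𝓘(ℝ, V) G (φ x₀))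
    (hφ : MDifferentiableAt I' I φ x₀) (u : TangentSpace I' x₀) :
    mvfderiv I' (fun x ↦ G (φ x)) x₀ u = mvfderiv I G (φ x₀) (mfderiv I' I φ x₀ u) :=
  mfderiv_comp_apply x₀ hG hφ u

theorem mvfderiv_clm_apply [I'.Boundaryless] {V W : Type*} [NormedAddCommGroup V]
    [NormedSpace ℝ V] [NormedAddCommGroup W] [NormedSpace ℝ W] {x₀ : M}
    {A : M → V →L[ℝ] W} {b : M → V} (hA : MDifferentiableAt I' 𝓘(ℝ, V →L[ℝ] W) A x₀)
    (hb : MDifferentiableAt I' 𝓘(ℝ, V) b x₀) (u : TangentSpace I' x₀) :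
    mvfderiv I' (fun x ↦ A x (b x)) x₀ u =
      mvfderiv I' A x₀ u (b x₀) + A x₀ (mvfderiv I' b x₀ u) := by
  have h : MDifferentiableAt I' 𝓘(ℝ, W) (fun x ↦ A x (b x)) x₀ := hA.clm_apply hb
  rw [mvfderiv_eq_fderiv h, mvfderiv_eq_fderiv hA, mvfderiv_eq_fderiv hb]
  have := fderiv_clm_apply (differentiableAt_comp_extChartAt_symm hA)
    (differentiableAt_comp_extChartAt_symm hb)
  have h2 : ((fun x ↦ A x (b x)) ∘ (extChartAt I' x₀).symm) = fun z ↦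
    (A ∘ (extChartAt I' x₀).symm) z ((b ∘ (extChartAt I' x₀).symm) z) := rfl
  rw [h2, this]
  simp [add_comm]

variable [RiemannianBundle (fun y : N ↦ TangentSpace I y)]

theorem mdifferentiableAt_inner_along {φ : M → N} {x₀ : M} {G : N → E →L[ℝ] E →L[ℝ] ℝ}
    (hG : IsLocalMetric I (φ x₀) G) (hφ : MDifferentiableAt I' I φ x₀)
    {W₁ W₂ : ∀ x : M, TangentSpace I (φ x)} (h₁ : DiffAlong I' I φ W₁ x₀)
    (h₂ : DiffAlong I' I φ W₂ x₀) :
    MDifferentiableAt I' 𝓘(ℝ, ℝ) (fun x ↦ ⟪W₁ x, W₂ x⟫) x₀ := by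
  have hG' : MDifferentiableAt I' 𝓘(ℝ, E →L[ℝ] E →L[ℝ] ℝ) (fun x ↦ G (φ x)) x₀ :=
    hG.mdifferentiableAt.comp x₀ hφ
  refine ((hG'.clm_apply h₁).clm_apply h₂).congr_of_eventuallyEq ?_
  filter_upwards [eventually_apply_mem_chart_source hφ] with x hx
  exact hG.inner_eq _ hx _ _

theorem mvfderiv_inner_comps [I'.Boundaryless] {φ : M → N} {x₀ : M} {G : N → E →L[ℝ] E →L[ℝ] ℝ}
    (hG : IsLocalMetric I (φ x₀) G) (hφ : MDifferentiableAt I' I φ x₀)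
    {W₁ W₂ : ∀ x : M, TangentSpace I (φ x)} (h₁ : DiffAlong I' I φ W₁ x₀)
    (h₂ : DiffAlong I' I φ W₂ x₀) (u : TangentSpace I' x₀) :
    mvfderiv I' (fun x ↦ ⟪W₁ x, W₂ x⟫) x₀ u =
      mvfderiv I G (φ x₀) (mfderiv I' I φ x₀ u) (comps I (φ x₀) (φ x₀) (W₁ x₀))
          (comps I (φ x₀) (φ x₀) (W₂ x₀))
        + ⟪ofComps I (φ x₀) (φ x₀) (derivComps I' I φ W₁ x₀ u), W₂ x₀⟫
        + ⟪W₁ x₀, ofComps I (φ x₀) (φ x₀) (derivComps I' I φ W₂ x₀ u)⟫ := by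
  have hG' : MDifferentiableAt I' 𝓘(ℝ, E →L[ℝ] E →L[ℝ] ℝ) (fun x ↦ G (φ x)) x₀ :=
    hG.mdifferentiableAt.comp x₀ hφ
  have h0 := mem_chart_source H (φ x₀)
  rw [hG.inner_eq _ h0, hG.inner_eq _ h0, comps_ofComps h0, comps_ofComps h0,
    ← mvfderiv_comp_vec hG.mdifferentiableAt hφ u]
  have h : (fun x ↦ ⟪W₁ x, W₂ x⟫) =ᶠ[𝓝 x₀] fun x ↦ G (φ x) (comps I (φ x₀) (φ x) (W₁ x))
      (comps I (φ x₀) (φ x) (W₂ x)) := by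
    filter_upwards [eventually_apply_mem_chart_source hφ] with x hx
    exact hG.inner_eq _ hx _ _
  rw [mvfderiv_congr h, mvfderiv_clm_apply (hG'.clm_apply h₁) h₂, mvfderiv_clm_apply hG' h₁]
  rfl

end AlongMap

section Ambient

variable {E : Type*} [NormedAddCommGroup E] [NormedSpace ℝ E] [FiniteDimensional ℝ E]
  {H : Type*} [TopologicalSpace H] {I : ModelWithCorners ℝ E H} [I.Boundaryless]
  {N : Type*} [TopologicalSpace N] [ChartedSpace H N] [IsManifold I ∞ N]

theorem derivComps_extend {y₀ : N} (v : TangentSpace I y₀) :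
    derivComps I I (fun y : N ↦ y) (FiberBundle.extend E v) y₀ = 0 := by
  have : (fun y : N ↦ comps I y₀ y (FiberBundle.extend E v y)) =ᶠ[𝓝 y₀]
      fun _ ↦ comps I y₀ y₀ v := by
    filter_upwards [eventually_mem_chart_source (H := H) y₀] with x hx using comps_extend hx v
  unfold derivComps
  rw [mvfderiv_congr this, mvfderiv_const]

theorem diffAlong_extend {y₀ : N} (v : TangentSpace I y₀) :
    DiffAlong I I (fun y : N ↦ y) (FiberBundle.extend E v) y₀ := by
  refine (mdifferentiableAt_const (c := comps I y₀ y₀ v)).congr_of_eventuallyEq ?_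
  filter_upwards [eventually_mem_chart_source (H := H) y₀] with x hx using comps_extend hx v

variable [RiemannianBundle (fun y : N ↦ TangentSpace I y)]
  
theorem mvfderiv_inner_fields {y₀ : N} {G : N → E →L[ℝ] E →L[ℝ] ℝ}
    (hG : IsLocalMetric I y₀ G)
    {X Y : ∀ y : N, TangentSpace I y} (hX : DiffAlong I I (fun y : N ↦ y) X y₀)
    (hY : DiffAlong I I (fun y : N ↦ y) Y y₀) (u : TangentSpace I y₀) :
    mvfderiv I (fun y ↦ ⟪X y, Y y⟫) y₀ u =
      mvfderiv I G y₀ u (comps I y₀ y₀ (X y₀)) (comps I y₀ y₀ (Y y₀))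
        + ⟪ofComps I y₀ y₀ (derivComps I I (fun y : N ↦ y) X y₀ u), Y y₀⟫
        + ⟪X y₀, ofComps I y₀ y₀ (derivComps I I (fun y : N ↦ y) Y y₀ u)⟫ := by
  have h := mvfderiv_inner_comps (φ := fun y : N ↦ y) hG mdifferentiableAt_id hX hY u
  have hid : mfderiv I I (fun y : N ↦ y) y₀ u = u := by
    change mfderiv I I id y₀ u = u
    rw [mfderiv_id]; rfl
  rwa [hid] at h

theorem koszul_extend_extend {y₀ : N} {G : N → E →L[ℝ] E →L[ℝ] ℝ}
    (hG : IsLocalMetric I y₀ G) {Y : ∀ y : N, TangentSpace I y}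
    (hY : DiffAlong I I (fun y : N ↦ y) Y y₀) (a c : TangentSpace I y₀) :
    koszul (FiberBundle.extend E a) Y (FiberBundle.extend E c) y₀ =
      2 * ⟪ofComps I y₀ y₀ (derivComps I I (fun y : N ↦ y) Y y₀ a), c⟫
        + mvfderiv I G y₀ a (comps I y₀ y₀ (Y y₀)) (comps I y₀ y₀ c)
        + mvfderiv I G y₀ (Y y₀) (comps I y₀ y₀ a) (comps I y₀ y₀ c)
        - mvfderiv I G y₀ c (comps I y₀ y₀ a) (comps I y₀ y₀ (Y y₀)) := by
  have h0 := mem_chart_source H y₀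
  have hbr : ∀ X Y : ∀ y : N, TangentSpace I y, DiffAlong I I (fun y : N ↦ y) X y₀ →
      DiffAlong I I (fun y : N ↦ y) Y y₀ → VectorField.mlieBracket I X Y y₀ =
        ofComps I y₀ y₀ (derivComps I I (fun y : N ↦ y) Y y₀ (X y₀)
          - derivComps I I (fun y : N ↦ y) X y₀ (Y y₀)) := by
    intro X Y hX hY
    rw [← ofComps_comps h0 (VectorField.mlieBracket I X Y y₀), comps_mlieBracket hX hY]
    rfl
  have ha := diffAlong_extend a
  have hc := diffAlong_extend c
  unfold koszul
  rw [mvfderiv_inner_fields hG hY hc, mvfderiv_inner_fields hG ha hc,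
    mvfderiv_inner_fields hG ha hY, hbr _ _ ha hY, hbr _ _ ha hc, hbr _ _ hY hc]
  simp only [derivComps_extend, FiberBundle.extend_apply_self, zero_apply,
    map_zero, inner_zero_left, inner_zero_right, sub_zero, zero_sub, map_neg, inner_neg_left]
  rw [real_inner_comm a]
  ring

set_option synthInstance.maxHeartbeats 200000 in
theorem inner_leviCivita {y₀ : N} {G : N → E →L[ℝ] E →L[ℝ] ℝ}
    (hG : IsLocalMetric I y₀ G) {Y : ∀ y : N, TangentSpace I y}
    (hY : DiffAlong I I (fun y : N ↦ y) Y y₀) (a c : TangentSpace I y₀) :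
    ⟪leviCivita Y y₀ a, c⟫ =
      ⟪ofComps I y₀ y₀ (derivComps I I (fun y : N ↦ y) Y y₀ a), c⟫
        + (mvfderiv I G y₀ a (comps I y₀ y₀ (Y y₀)) (comps I y₀ y₀ c)
        + mvfderiv I G y₀ (Y y₀) (comps I y₀ y₀ a) (comps I y₀ y₀ c)
        - mvfderiv I G y₀ c (comps I y₀ y₀ a) (comps I y₀ y₀ (Y y₀))) / 2 := by
  let Λ : TangentSpace I y₀ →ₗ[ℝ] ℝ :=
    { toFun := fun c ↦ ⟪ofComps I y₀ y₀ (derivComps I I (fun y : N ↦ y) Y y₀ a), c⟫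
        + (mvfderiv I G y₀ a (comps I y₀ y₀ (Y y₀)) (comps I y₀ y₀ c)
        + mvfderiv I G y₀ (Y y₀) (comps I y₀ y₀ a) (comps I y₀ y₀ c)
        - mvfderiv I G y₀ c (comps I y₀ y₀ a) (comps I y₀ y₀ (Y y₀))) / 2
      map_add' := fun c d ↦ by simp [inner_add_right]; ring
      map_smul' := fun r c ↦ by simp [inner_smul_right]; ring }
  change _ = Λ c
  have hΛ : ∀ e, koszul (FiberBundle.extend E a) Y (FiberBundle.extend E e) y₀ / 2 = Λ e := by
    intro e
    rw [koszul_extend_extend hG hY]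
    simp only [Λ, LinearMap.coe_mk, AddHom.coe_mk]
    ring
  unfold leviCivita
  simp only [hΛ, sum_inner, inner_smul_left]
  conv_rhs => rw [← (stdOrthonormalBasis ℝ (TangentSpace I y₀)).sum_repr' c, map_sum]
  simp [mul_comm]

theorem leviCivita_eq_add {y₀ : N} {G : N → E →L[ℝ] E →L[ℝ] ℝ}
    (hG : IsLocalMetric I y₀ G) {Y : ∀ y : N, TangentSpace I y}
    (hY : DiffAlong I I (fun y : N ↦ y) Y y₀) (a : TangentSpace I y₀) :
    leviCivita Y y₀ a =
      ofComps I y₀ y₀ (derivComps I I (fun y : N ↦ y) Y y₀ a)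
        + leviCivita (FiberBundle.extend E (Y y₀)) y₀ a := by
  refine ext_inner_right ℝ fun c ↦ ?_
  rw [inner_add_left, inner_leviCivita hG hY, inner_leviCivita hG (diffAlong_extend (Y y₀)),
    derivComps_extend, FiberBundle.extend_apply_self]
  simp

end Ambient

section Christoffel

variable {E : Type*} [NormedAddCommGroup E] [NormedSpace ℝ E] [FiniteDimensional ℝ E]
  {H : Type*} [TopologicalSpace H] {I : ModelWithCorners ℝ E H} [I.Boundaryless]
  {N : Type*} [TopologicalSpace N] [ChartedSpace H N] [IsManifold I ∞ N]
  [RiemannianBundle (fun y : N ↦ TangentSpace I y)]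
  [IsContMDiffRiemannianBundle I ∞ E (fun y : N ↦ TangentSpace I y)]

theorem inner_leviCivita_extend {y₀ : N} {G : N → E →L[ℝ] E →L[ℝ] ℝ}
    (hG : IsLocalMetric I y₀ G) (a b c : TangentSpace I y₀) :
    ⟪leviCivita (FiberBundle.extend E b) y₀ a, c⟫ =
      (mvfderiv I G y₀ a (comps I y₀ y₀ b) (comps I y₀ y₀ c)
        + mvfderiv I G y₀ b (comps I y₀ y₀ a) (comps I y₀ y₀ c)
        - mvfderiv I G y₀ c (comps I y₀ y₀ a) (comps I y₀ y₀ b)) / 2 := by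
  rw [inner_leviCivita hG (diffAlong_extend b), derivComps_extend, FiberBundle.extend_apply_self]
  simp

theorem mvfderiv_localMetric_comm {y₀ : N} {G : N → E →L[ℝ] E →L[ℝ] ℝ}
    (hG : IsLocalMetric I y₀ G) (a b c : TangentSpace I y₀) :
    mvfderiv I G y₀ a (comps I y₀ y₀ b) (comps I y₀ y₀ c) =
      mvfderiv I G y₀ a (comps I y₀ y₀ c) (comps I y₀ y₀ b) := by
  have h : ∀ b c : TangentSpace I y₀,
      mvfderiv I (fun y ↦ ⟪FiberBundle.extend E b y, FiberBundle.extend E c y⟫) y₀ a =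
      mvfderiv I G y₀ a (comps I y₀ y₀ b) (comps I y₀ y₀ c) := by
    intro b c
    rw [mvfderiv_inner_fields hG (diffAlong_extend b) (diffAlong_extend c)]
    simp [derivComps_extend]
  rw [← h, ← h]
  simp only [real_inner_comm]

set_option synthInstance.maxHeartbeats 200000 in
variable (I) in
/-- The Christoffel map at `y₀` of the chart around `y₀`: the derivative in the direction of the
first argument of the extension of the second with constant components. -/
def christoffel (y₀ : N) : TangentSpace I y₀ →ₗ[ℝ] TangentSpace I y₀ →ₗ[ℝ] TangentSpace I y₀ :=
  LinearMap.mk₂ ℝ (fun a b ↦ leviCivita (FiberBundle.extend E b) y₀ a)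
    (fun a b c ↦ by
      obtain ⟨G, hG⟩ := exists_isLocalMetric (I := I) y₀
      refine ext_inner_right ℝ fun d ↦ ?_
      simp only [inner_add_left, inner_leviCivita_extend hG, map_add, add_apply]
      ring)
    (fun r a b ↦ by
      obtain ⟨G, hG⟩ := exists_isLocalMetric (I := I) y₀
      refine ext_inner_right ℝ fun d ↦ ?_
      simp only [real_inner_smul_left, inner_leviCivita_extend hG, map_smul, smul_apply,
        smul_eq_mul]
      ring)
    (fun a b c ↦ by
      obtain ⟨G, hG⟩ := exists_isLocalMetric (I := I) y₀
      refine ext_inner_right ℝ fun d ↦ ?_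
      simp only [inner_add_left, inner_leviCivita_extend hG, map_add, add_apply]
      ring)
    (fun r a b ↦ by
      obtain ⟨G, hG⟩ := exists_isLocalMetric (I := I) y₀
      refine ext_inner_right ℝ fun d ↦ ?_
      simp only [real_inner_smul_left, inner_leviCivita_extend hG, map_smul, smul_apply,
        smul_eq_mul]
      ring)

theorem leviCivita_extend {y₀ : N} (a b : TangentSpace I y₀) :
    leviCivita (FiberBundle.extend E b) y₀ a = christoffel I y₀ a b := rfl

theorem inner_christoffel {y₀ : N} {G : N → E →L[ℝ] E →L[ℝ] ℝ}
    (hG : IsLocalMetric I y₀ G) (a b c : TangentSpace I y₀) :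
    ⟪christoffel I y₀ a b, c⟫ =
      (mvfderiv I G y₀ a (comps I y₀ y₀ b) (comps I y₀ y₀ c)
        + mvfderiv I G y₀ b (comps I y₀ y₀ a) (comps I y₀ y₀ c)
        - mvfderiv I G y₀ c (comps I y₀ y₀ a) (comps I y₀ y₀ b)) / 2 :=
  inner_leviCivita_extend hG a b c

theorem christoffel_comm {y₀ : N} (a b : TangentSpace I y₀) :
    christoffel I y₀ a b = christoffel I y₀ b a := by
  obtain ⟨G, hG⟩ := exists_isLocalMetric (I := I) y₀
  refine ext_inner_right ℝ fun c ↦ ?_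
  rw [inner_christoffel hG, inner_christoffel hG, mvfderiv_localMetric_comm hG c]
  ring

theorem leviCivita_eq {y₀ : N} {Y : ∀ y : N, TangentSpace I y}
    (hY : DiffAlong I I (fun y : N ↦ y) Y y₀) (a : TangentSpace I y₀) :
    leviCivita Y y₀ a =
      ofComps I y₀ y₀ (derivComps I I (fun y : N ↦ y) Y y₀ a) + christoffel I y₀ a (Y y₀) := by
  obtain ⟨G, hG⟩ := exists_isLocalMetric (I := I) y₀
  exact leviCivita_eq_add hG hY a

section Along

variable {E' : Type*} [NormedAddCommGroup E'] [NormedSpace ℝ E']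
  {H' : Type*} [TopologicalSpace H'] {I' : ModelWithCorners ℝ E' H'} [I'.Boundaryless]
  {M : Type*} [TopologicalSpace M] [ChartedSpace H' M] [IsManifold I' ∞ M]

theorem covAlong_eq {φ : M → N} {x₀ : M} (hφ : MDifferentiableAt I' I φ x₀)
    (W : ∀ x : M, TangentSpace I (φ x)) (u : TangentSpace I' x₀) :
    covAlong I' I φ W x₀ u = ofComps I (φ x₀) (φ x₀) (derivComps I' I φ W x₀ u)
      + christoffel I (φ x₀) (mfderiv I' I φ x₀ u) (W x₀) := by
  have h0 := mem_chart_source H (φ x₀)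
  unfold covAlong
  rw [leviCivita_extend]
  congr 1
  refine ((trivializationAt E (fun y : N ↦ TangentSpace I y) (φ x₀)).symmL_apply (R := ℝ)
    (by exact h0) _).symm.trans ?_
  unfold ofComps derivComps
  congr 2
  refine mvfderiv_congr ?_
  filter_upwards [eventually_apply_mem_chart_source hφ] with x hx
  exact trivializationAt_snd hx (W x)

theorem mdifferentiableAt_inner_of_diffAlong {φ : M → N} {x₀ : M}
    (hφ : MDifferentiableAt I' I φ x₀)
    {W₁ W₂ : ∀ x : M, TangentSpace I (φ x)} (h₁ : DiffAlong I' I φ W₁ x₀)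
    (h₂ : DiffAlong I' I φ W₂ x₀) :
    MDifferentiableAt I' 𝓘(ℝ, ℝ) (fun x ↦ ⟪W₁ x, W₂ x⟫) x₀ := by
  obtain ⟨G, hG⟩ := exists_isLocalMetric (I := I) (φ x₀)
  exact mdifferentiableAt_inner_along hG hφ h₁ h₂

/-- The Levi-Civita connection pulled back along a map is metric. -/
theorem mvfderiv_inner_along {φ : M → N} {x₀ : M} (hφ : MDifferentiableAt I' I φ x₀)
    {W₁ W₂ : ∀ x : M, TangentSpace I (φ x)} (h₁ : DiffAlong I' I φ W₁ x₀)
    (h₂ : DiffAlong I' I φ W₂ x₀) (u : TangentSpace I' x₀) :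
    mvfderiv I' (fun x ↦ ⟪W₁ x, W₂ x⟫) x₀ u =
      ⟪covAlong I' I φ W₁ x₀ u, W₂ x₀⟫ + ⟪W₁ x₀, covAlong I' I φ W₂ x₀ u⟫ := by
  obtain ⟨G, hG⟩ := exists_isLocalMetric (I := I) (φ x₀)
  rw [mvfderiv_inner_comps hG hφ h₁ h₂, covAlong_eq hφ, covAlong_eq hφ, inner_add_left,
    inner_add_right, inner_christoffel hG, ← real_inner_comm (W₁ x₀) (christoffel _ _ _ _),
    inner_christoffel hG, mvfderiv_localMetric_comm hG _ (W₂ x₀) (W₁ x₀),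
    mvfderiv_localMetric_comm hG (W₁ x₀), mvfderiv_localMetric_comm hG (W₂ x₀)]
  ring

end Along

section AlmostComplex

variable (J : ∀ y : N, TangentSpace I y →L[ℝ] TangentSpace I y)

/-- The covariant derivative `(∇_a J) b` of an endomorphism field. -/
def nablaEnd (y₀ : N) (a b : TangentSpace I y₀) : TangentSpace I y₀ :=
  leviCivita (fun z ↦ J z (FiberBundle.extend E b z)) y₀ a - J y₀ (christoffel I y₀ a b)

variable {J}

theorem IsAlmostHermitian.inner_map_left (hJ : IsAlmostHermitian J) {y : N}
    (u v : TangentSpace I y) : ⟪J y u, v⟫ = -⟪u, J y v⟫ := by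
  rw [← hJ.inner_map_map y (J y u) v, hJ.sq, inner_neg_left]

variable {E' : Type*} [NormedAddCommGroup E'] [NormedSpace ℝ E']
  {H' : Type*} [TopologicalSpace H'] {I' : ModelWithCorners ℝ E' H'} [I'.Boundaryless]
  {M : Type*} [TopologicalSpace M] [ChartedSpace H' M] [IsManifold I' ∞ M]

theorem diffAlong_map (hJ : IsAlmostHermitian J) {φ : M → N} {x₀ : M}
    (hφ : MDifferentiableAt I' I φ x₀)
    {W : ∀ x : M, TangentSpace I (φ x)} (hW : DiffAlong I' I φ W x₀) :
    DiffAlong I' I φ (fun x ↦ J (φ x) (W x)) x₀ := by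
  obtain ⟨A, hA, hAJ⟩ := exists_local_endomorphism J hJ.contMDiff (φ x₀)
  have hA' : MDifferentiableAt I' 𝓘(ℝ, E →L[ℝ] E) (fun x ↦ A (φ x)) x₀ := hA.comp x₀ hφ
  refine (hA'.clm_apply hW).congr_of_eventuallyEq ?_
  filter_upwards [eventually_apply_mem_chart_source hφ] with x hx
  exact hAJ _ hx _

theorem derivComps_map {φ : M → N} {x₀ : M} {A : N → E →L[ℝ] E}
    (hA : MDifferentiableAt I 𝓘(ℝ, E →L[ℝ] E) A (φ x₀))
    (hAJ : ∀ y ∈ (chartAt H (φ x₀)).source, ∀ v : TangentSpace I y,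
        comps I (φ x₀) y (J y v) = A y (comps I (φ x₀) y v))
    (hφ : MDifferentiableAt I' I φ x₀)
    {W : ∀ x : M, TangentSpace I (φ x)} (hW : DiffAlong I' I φ W x₀) (u : TangentSpace I' x₀) :
    derivComps I' I φ (fun x ↦ J (φ x) (W x)) x₀ u =
      mvfderiv I A (φ x₀) (mfderiv I' I φ x₀ u) (comps I (φ x₀) (φ x₀) (W x₀))
        + A (φ x₀) (derivComps I' I φ W x₀ u) := by
  have hA' : MDifferentiableAt I' 𝓘(ℝ, E →L[ℝ] E) (fun x ↦ A (φ x)) x₀ := hA.comp x₀ hφ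
  have h : (fun x ↦ comps I (φ x₀) (φ x) (J (φ x) (W x))) =ᶠ[𝓝 x₀]
      fun x ↦ A (φ x) (comps I (φ x₀) (φ x) (W x)) := by
    filter_upwards [eventually_apply_mem_chart_source hφ] with x hx using hAJ _ hx _
  rw [← mvfderiv_comp_vec hA hφ u]
  unfold derivComps
  rw [mvfderiv_congr h]
  exact mvfderiv_clm_apply hA' hW u

theorem nablaEnd_eq (hJ : IsAlmostHermitian J) {y₀ : N} {A : N → E →L[ℝ] E}
    (hA : MDifferentiableAt I 𝓘(ℝ, E →L[ℝ] E) A y₀)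
    (hAJ : ∀ y ∈ (chartAt H y₀).source, ∀ v : TangentSpace I y,
        comps I y₀ y (J y v) = A y (comps I y₀ y v)) (a b : TangentSpace I y₀) :
    nablaEnd J y₀ a b = ofComps I y₀ y₀ (mvfderiv I A y₀ a (comps I y₀ y₀ b))
      + christoffel I y₀ a (J y₀ b) - J y₀ (christoffel I y₀ a b) := by
  have hid : mfderiv I I (fun y : N ↦ y) y₀ a = a := by
    change mfderiv I I id y₀ a = a
    rw [mfderiv_id]; rfl
  have hd := diffAlong_extend b
  unfold nablaEnd
  rw [leviCivita_eq (diffAlong_map (φ := fun y : N ↦ y) hJ mdifferentiableAt_id hd),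
    derivComps_map (φ := fun y : N ↦ y) hA hAJ mdifferentiableAt_id hd, derivComps_extend,
    FiberBundle.extend_apply_self, hid, zero_apply, map_zero, add_zero]

theorem covAlong_map (hJ : IsAlmostHermitian J) {φ : M → N} {x₀ : M}
    (hφ : MDifferentiableAt I' I φ x₀)
    {W : ∀ x : M, TangentSpace I (φ x)} (hW : DiffAlong I' I φ W x₀) (u : TangentSpace I' x₀) :
    covAlong I' I φ (fun x ↦ J (φ x) (W x)) x₀ u =
      nablaEnd J (φ x₀) (mfderiv I' I φ x₀ u) (W x₀) + J (φ x₀) (covAlong I' I φ W x₀ u) := by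
  obtain ⟨A, hA, hAJ⟩ := exists_local_endomorphism J hJ.contMDiff (φ x₀)
  have h0 := mem_chart_source H (φ x₀)
  have hJA : ∀ e : E, J (φ x₀) (ofComps I (φ x₀) (φ x₀) e) =
      ofComps I (φ x₀) (φ x₀) (A (φ x₀) e) := by
    intro e
    refine comps_injective h0 ?_
    rw [hAJ _ h0, comps_ofComps h0, comps_ofComps h0]
  rw [covAlong_eq hφ, covAlong_eq hφ, nablaEnd_eq hJ hA hAJ, derivComps_map hA hAJ hφ hW,
    map_add, map_add, hJA]
  abel

theorem nablaEnd_add_left (hJ : IsAlmostHermitian J) {y₀ : N} (a a' b : TangentSpace I y₀) :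
    nablaEnd J y₀ (a + a') b = nablaEnd J y₀ a b + nablaEnd J y₀ a' b := by
  obtain ⟨A, hA, hAJ⟩ := exists_local_endomorphism J hJ.contMDiff y₀
  simp only [nablaEnd_eq hJ hA hAJ, map_add, add_apply, LinearMap.add_apply]
  abel

theorem nablaEnd_add_right (hJ : IsAlmostHermitian J) {y₀ : N} (a b b' : TangentSpace I y₀) :
    nablaEnd J y₀ a (b + b') = nablaEnd J y₀ a b + nablaEnd J y₀ a b' := by
  obtain ⟨A, hA, hAJ⟩ := exists_local_endomorphism J hJ.contMDiff y₀
  simp only [nablaEnd_eq hJ hA hAJ, map_add]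
  abel

theorem IsNearlyKaehler.nablaEnd_self (hJ : IsNearlyKaehler J) {y₀ : N} (a : TangentSpace I y₀) :
    nablaEnd J y₀ a a = 0 := by
  have h := hJ.nabla_self (FiberBundle.extend E a) y₀
    (mdifferentiableAt_section_iff_comps.2 (diffAlong_extend a))
  rwa [FiberBundle.extend_apply_self] at h

theorem IsNearlyKaehler.nablaEnd_swap (hJ : IsNearlyKaehler J) {y₀ : N}
    (a b : TangentSpace I y₀) : nablaEnd J y₀ a b = -nablaEnd J y₀ b a := by
  have h := hJ.nablaEnd_self (a + b)
  rw [nablaEnd_add_left hJ.toIsAlmostHermitian, nablaEnd_add_right hJ.toIsAlmostHermitian,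
    nablaEnd_add_right hJ.toIsAlmostHermitian, hJ.nablaEnd_self, hJ.nablaEnd_self, zero_add,
    add_zero] at h
  exact eq_neg_of_add_eq_zero_left h

theorem inner_nablaEnd (hJ : IsAlmostHermitian J) {y₀ : N} (a b c : TangentSpace I y₀) :
    ⟪nablaEnd J y₀ a b, c⟫ = -⟪b, nablaEnd J y₀ a c⟫ := by
  have hid : mfderiv I I (fun y : N ↦ y) y₀ a = a := by
    change mfderiv I I id y₀ a = a
    rw [mfderiv_id]; rfl
  have hφ : MDifferentiableAt I I (fun y : N ↦ y) y₀ := mdifferentiableAt_id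
  have hb := diffAlong_extend b
  have hc := diffAlong_extend c
  have hJ1 := mvfderiv_inner_along hφ (diffAlong_map hJ hφ hb) hc a
  have hJ2 := mvfderiv_inner_along hφ hb (diffAlong_map hJ hφ hc) a
  have hs : (fun y ↦ ⟪J y (FiberBundle.extend E b y), FiberBundle.extend E c y⟫) =
      -fun y ↦ ⟪FiberBundle.extend E b y, J y (FiberBundle.extend E c y)⟫ := by
    ext y
    exact hJ.inner_map_left _ _
  rw [hs, mvfderiv_neg, neg_apply, hJ2, covAlong_map hJ hφ hb, covAlong_map hJ hφ hc, hid] at hJ1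
  simp only [FiberBundle.extend_apply_self, inner_add_left, inner_add_right,
    hJ.inner_map_left] at hJ1
  rw [← hJ.inner_map_left b] at hJ1
  linarith [hJ.inner_map_left b (covAlong I I (fun y : N ↦ y) (FiberBundle.extend E c) y₀ a)]

end AlmostComplex

end Christoffel

section Hessian

variable {E' : Type*} [NormedAddCommGroup E'] [NormedSpace ℝ E']
  {H' : Type*} [TopologicalSpace H'] {I' : ModelWithCorners ℝ E' H'} [I'.Boundaryless]
  {M : Type*} [TopologicalSpace M] [ChartedSpace H' M] [IsManifold I' ∞ M]
  {E : Type*} [NormedAddCommGroup E] [NormedSpace ℝ E] [FiniteDimensional ℝ E]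
  {H : Type*} [TopologicalSpace H] {I : ModelWithCorners ℝ E H} [I.Boundaryless]
  {N : Type*} [TopologicalSpace N] [ChartedSpace H N] [IsManifold I ∞ N]

theorem contDiffAt_writtenInExtChartAt {φ : M → N} (hφ : ContMDiff I' I ∞ φ) (x₀ : M) :
    ContDiffAt ℝ ∞ (writtenInExtChartAt I' I x₀ φ) (extChartAt I' x₀ x₀) := by
  have h := (contMDiffAt_iff.1 (hφ x₀)).2
  rwa [I'.range_eq_univ, contDiffWithinAt_univ] at h

theorem comps_mfderiv_extend {φ : M → N} (hφ : ContMDiff I' I ∞ φ) (x₀ : M)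
    (v : TangentSpace I' x₀) :
    (fun x ↦ comps I (φ x₀) (φ x) (mfderiv I' I φ x (FiberBundle.extend E' v x))) =ᶠ[𝓝 x₀]
      fun x ↦ fderiv ℝ (writtenInExtChartAt I' I x₀ φ) (extChartAt I' x₀ x)
        (comps I' x₀ x₀ v) := by
  have hφ' : MDifferentiable I' I φ := hφ.mdifferentiable (by simp)
  have hd : ∀ᶠ x in 𝓝 x₀,
      DifferentiableAt ℝ (writtenInExtChartAt I' I x₀ φ) (extChartAt I' x₀ x) := by
    have h1 : ∀ᶠ z in 𝓝 (extChartAt I' x₀ x₀),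
        ContDiffAt ℝ 1 (writtenInExtChartAt I' I x₀ φ) z :=
      ((contDiffAt_writtenInExtChartAt hφ x₀).of_le (by simp)).eventually (by simp)
    filter_upwards [(continuousAt_extChartAt (I := I') x₀).eventually h1] with x hx
    exact hx.differentiableAt (by simp)
  filter_upwards [hd, eventually_mem_chart_source (H := H') x₀,
    eventually_apply_mem_chart_source (hφ' x₀)] with x hdx hx hx'
  have h2 : (fun x ↦ writtenInExtChartAt I' I x₀ φ (extChartAt I' x₀ x)) =ᶠ[𝓝 x]
      fun x ↦ extChartAt I (φ x₀) (φ x) := by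
    filter_upwards [(chartAt H' x₀).open_source.mem_nhds hx] with y hy
    simp only [writtenInExtChartAt, Function.comp_apply]
    rw [(extChartAt I' x₀).left_inv (by rwa [extChartAt_source])]
  rw [← comps_extend hx v, ← mvfderiv_comp_extChartAt hx hdx, mvfderiv_congr h2,
    comps_eq_mfderiv hx']
  exact (mvfderiv_comp_vec (mdifferentiableAt_extChartAt hx') (hφ' x) _).symm

theorem differentiableAt_fderiv_written {φ : M → N} (hφ : ContMDiff I' I ∞ φ) (x₀ : M) :
    DifferentiableAt ℝ (fderiv ℝ (writtenInExtChartAt I' I x₀ φ)) (extChartAt I' x₀ x₀) :=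
  ((contDiffAt_writtenInExtChartAt hφ x₀).fderiv_right (m := 1)
    (by rw [one_add_one_eq_two]; exact ENat.LEInfty.out)).differentiableAt (by simp)

theorem diffAlong_mfderiv_extend {φ : M → N} (hφ : ContMDiff I' I ∞ φ) {x₀ : M}
    (v : TangentSpace I' x₀) :
    DiffAlong I' I φ (fun x ↦ mfderiv I' I φ x (FiberBundle.extend E' v x)) x₀ := by
  refine MDifferentiableAt.congr_of_eventuallyEq ?_ (comps_mfderiv_extend hφ x₀ v)
  have h := ((differentiableAt_fderiv_written hφ x₀).clm_apply
    (differentiableAt_const (comps I' x₀ x₀ v)))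
  exact h.mdifferentiableAt.comp x₀ (mdifferentiableAt_extChartAt (mem_chart_source H' x₀))

theorem derivComps_mfderiv_extend {φ : M → N} (hφ : ContMDiff I' I ∞ φ) {x₀ : M}
    (u v : TangentSpace I' x₀) :
    derivComps I' I φ (fun x ↦ mfderiv I' I φ x (FiberBundle.extend E' v x)) x₀ u =
      fderiv ℝ (fderiv ℝ (writtenInExtChartAt I' I x₀ φ)) (extChartAt I' x₀ x₀)
        (comps I' x₀ x₀ u) (comps I' x₀ x₀ v) := by
  have hd := differentiableAt_fderiv_written hφ x₀
  have h := hd.clm_apply (differentiableAt_const (comps I' x₀ x₀ v))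
  unfold derivComps
  rw [mvfderiv_congr (comps_mfderiv_extend hφ x₀ v),
    mvfderiv_comp_extChartAt (mem_chart_source H' x₀) h,
    fderiv_clm_apply hd (differentiableAt_const _)]
  simp

variable [RiemannianBundle (fun y : N ↦ TangentSpace I y)]
  [IsContMDiffRiemannianBundle I ∞ E (fun y : N ↦ TangentSpace I y)]

variable (I' I) in
/-- The second covariant derivative of `φ` in the chart around `x₀`: `hess u v` is the derivative
in the direction `u` of the image of the extension of `v` with constant components. -/
def hess (φ : M → N) (x₀ : M) :
    TangentSpace I' x₀ →ₗ[ℝ] TangentSpace I' x₀ →ₗ[ℝ] TangentSpace I (φ x₀) :=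
  LinearMap.mk₂ ℝ (fun u v ↦ ofComps I (φ x₀) (φ x₀)
      (fderiv ℝ (fderiv ℝ (writtenInExtChartAt I' I x₀ φ)) (extChartAt I' x₀ x₀)
        (comps I' x₀ x₀ u) (comps I' x₀ x₀ v))
      + christoffel I (φ x₀) (mfderiv I' I φ x₀ u) (mfderiv I' I φ x₀ v))
    (fun u u' v ↦ by simp only [map_add, add_apply, LinearMap.add_apply]; abel)
    (fun r u v ↦ by simp only [map_smul, smul_apply, LinearMap.smul_apply, smul_add])
    (fun u v v' ↦ by simp only [map_add]; abel)
    (fun r u v ↦ by simp only [map_smul, smul_add])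

theorem covAlong_mfderiv_extend {φ : M → N} (hφ : ContMDiff I' I ∞ φ) {x₀ : M}
    (u v : TangentSpace I' x₀) :
    covAlong I' I φ (fun x ↦ mfderiv I' I φ x (FiberBundle.extend E' v x)) x₀ u =
      hess I' I φ x₀ u v := by
  rw [covAlong_eq (hφ.mdifferentiable (by simp) x₀), derivComps_mfderiv_extend hφ,
    FiberBundle.extend_apply_self]
  rfl

theorem hess_comm {φ : M → N} (hφ : ContMDiff I' I ∞ φ) {x₀ : M} (u v : TangentSpace I' x₀) :
    hess I' I φ x₀ u v = hess I' I φ x₀ v u := by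
  have hs : IsSymmSndFDerivAt ℝ (writtenInExtChartAt I' I x₀ φ) (extChartAt I' x₀ x₀) :=
    (contDiffAt_writtenInExtChartAt hφ x₀).isSymmSndFDerivAt
      (by rw [minSmoothness_of_isRCLikeNormedField]; exact ENat.LEInfty.out)
  have h1 := hs.eq (comps I' x₀ x₀ u) (comps I' x₀ x₀ v)
  have h2 := christoffel_comm (I := I) (mfderiv I' I φ x₀ u) (mfderiv I' I φ x₀ v)
  simp only [hess, LinearMap.mk₂_apply]
  rw [h1, h2]

theorem secondFundamentalForm_eq {φ : M → N} (hφ : ContMDiff I' I ∞ φ) (x : M)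
    (u v : TangentSpace I' x) :
    secondFundamentalForm I' I φ x u v = normalPart I' I φ x (hess I' I φ x u v) := by
  unfold secondFundamentalForm
  rw [covAlong_mfderiv_extend hφ]

theorem mvfderiv_inner_mfderiv {φ : M → N} (hφ : ContMDiff I' I ∞ φ) {x : M}
    (u v w : TangentSpace I' x) :
    mvfderiv I' (fun z ↦ ⟪mfderiv I' I φ z (FiberBundle.extend E' v z),
        mfderiv I' I φ z (FiberBundle.extend E' w z)⟫) x u =
      ⟪hess I' I φ x u v, mfderiv I' I φ x w⟫ + ⟪mfderiv I' I φ x v, hess I' I φ x u w⟫ := by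
  rw [mvfderiv_inner_along (hφ.mdifferentiable (by simp) x) (diffAlong_mfderiv_extend hφ v)
    (diffAlong_mfderiv_extend hφ w), covAlong_mfderiv_extend hφ, covAlong_mfderiv_extend hφ,
    FiberBundle.extend_apply_self, FiberBundle.extend_apply_self]

theorem inner_hess {φ : M → N} (hφ : ContMDiff I' I ∞ φ) {x : M} (u v w : TangentSpace I' x) :
    2 * ⟪hess I' I φ x u v, mfderiv I' I φ x w⟫ =
      mvfderiv I' (fun z ↦ ⟪mfderiv I' I φ z (FiberBundle.extend E' v z),
        mfderiv I' I φ z (FiberBundle.extend E' w z)⟫) x u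
      + mvfderiv I' (fun z ↦ ⟪mfderiv I' I φ z (FiberBundle.extend E' u z),
        mfderiv I' I φ z (FiberBundle.extend E' w z)⟫) x v
      - mvfderiv I' (fun z ↦ ⟪mfderiv I' I φ z (FiberBundle.extend E' u z),
        mfderiv I' I φ z (FiberBundle.extend E' v z)⟫) x w := by
  rw [mvfderiv_inner_mfderiv hφ, mvfderiv_inner_mfderiv hφ, mvfderiv_inner_mfderiv hφ,
    hess_comm hφ v u, hess_comm hφ w u, hess_comm hφ w v, real_inner_comm (hess I' I φ x u w),
    real_inner_comm (hess I' I φ x v w)]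
  ring

variable {J : ∀ y : N, TangentSpace I y →L[ℝ] TangentSpace I y}

theorem mdifferentiableAt_inner_map_mfderiv (hJ : IsAlmostHermitian J) {φ : M → N}
    (hφ : ContMDiff I' I ∞ φ) {x : M} (v w : TangentSpace I' x) :
    MDifferentiableAt I' 𝓘(ℝ, ℝ) (fun z ↦
        ⟪J (φ z) (mfderiv I' I φ z (FiberBundle.extend E' v z)),
        mfderiv I' I φ z (FiberBundle.extend E' w z)⟫) x :=
  have h := hφ.mdifferentiable (by simp) x
  mdifferentiableAt_inner_of_diffAlong h
    (diffAlong_map hJ h (diffAlong_mfderiv_extend hφ v)) (diffAlong_mfderiv_extend hφ w)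

theorem mvfderiv_inner_map_mfderiv (hJ : IsAlmostHermitian J) {φ : M → N}
    (hφ : ContMDiff I' I ∞ φ) {x : M} (u v w : TangentSpace I' x) :
    mvfderiv I' (fun z ↦ ⟪J (φ z) (mfderiv I' I φ z (FiberBundle.extend E' v z)),
        mfderiv I' I φ z (FiberBundle.extend E' w z)⟫) x u =
      ⟪nablaEnd J (φ x) (mfderiv I' I φ x u) (mfderiv I' I φ x v), mfderiv I' I φ x w⟫
        + ⟪J (φ x) (hess I' I φ x u v), mfderiv I' I φ x w⟫
        + ⟪J (φ x) (mfderiv I' I φ x v), hess I' I φ x u w⟫ := by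
  have h := hφ.mdifferentiable (by simp) x
  have hv := diffAlong_mfderiv_extend hφ v
  rw [mvfderiv_inner_along h (diffAlong_map hJ h hv) (diffAlong_mfderiv_extend hφ w),
    covAlong_map hJ h hv, covAlong_mfderiv_extend hφ, covAlong_mfderiv_extend hφ,
    FiberBundle.extend_apply_self, FiberBundle.extend_apply_self, inner_add_left]

end Hessian

section LinearAlgebra

variable {V : Type*} [NormedAddCommGroup V] [InnerProductSpace ℝ V]
  {ι κ : Type*} [Fintype ι] [Fintype κ]

/-- The trace of a bilinear map with respect to the inner product does not depend on the
orthonormal basis. -/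
theorem sum_orthonormalBasis_eq {W : Type*} [AddCommGroup W] [Module ℝ W]
    (b : OrthonormalBasis ι ℝ V) (c : OrthonormalBasis κ ℝ V) (B : V →ₗ[ℝ] V →ₗ[ℝ] W) :
    ∑ i, B (b i) (b i) = ∑ k, B (c k) (c k) := by
  classical
  have h1 : ∀ i, B (b i) (b i) = ∑ k, ∑ l, (⟪c k, b i⟫ * ⟪b i, c l⟫) • B (c k) (c l) := by
    intro i
    have h : b i = ∑ k, ⟪c k, b i⟫ • c k := (c.sum_repr' (b i)).symm
    conv_lhs => rw [h]
    simp only [map_sum, map_smul, LinearMap.sum_apply, LinearMap.smul_apply, Finset.smul_sum,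
      smul_smul]
    rw [Finset.sum_comm]
    refine Finset.sum_congr rfl fun k _ ↦ Finset.sum_congr rfl fun l _ ↦ ?_
    rw [real_inner_comm (c l), mul_comm]
  simp only [h1]
  rw [Finset.sum_comm]
  refine Finset.sum_congr rfl fun k _ ↦ ?_
  rw [Finset.sum_comm]
  simp only [← Finset.sum_smul, b.sum_inner_mul_inner]
  simp [orthonormal_iff_ite.1 c.orthonormal, ite_smul]

theorem sum_sq_orthonormalBasis_eq {W : Type*} [NormedAddCommGroup W] [InnerProductSpace ℝ W]
    (b : OrthonormalBasis ι ℝ V) (c : OrthonormalBasis κ ℝ V) (B : V →ₗ[ℝ] V →ₗ[ℝ] W) :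
    ∑ i, ∑ j, ⟪B (b i) (b j), B (b i) (b j)⟫ = ∑ k, ∑ l, ⟪B (c k) (c l), B (c k) (c l)⟫ := by
  have h1 : ∀ u : V, ∑ i, ⟪B u (b i), B u (b i)⟫ = ∑ k, ⟪B u (c k), B u (c k)⟫ := fun u ↦
    sum_orthonormalBasis_eq b c ((innerₗ W).compl₁₂ (B u) (B u))
  have h2 : ∀ v : V, ∑ i, ⟪B (b i) v, B (b i) v⟫ = ∑ k, ⟪B (c k) v, B (c k) v⟫ := fun v ↦
    sum_orthonormalBasis_eq b c ((innerₗ W).compl₁₂ (B.flip v) (B.flip v))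
  simp only [h1]
  rw [Finset.sum_comm]
  simp only [h2]
  rw [Finset.sum_comm]

variable [FiniteDimensional ℝ V]

/-- An orthonormal basis adapted to a subspace and its orthogonal complement. -/
def adaptedBasis (D : Submodule ℝ V) :
    OrthonormalBasis (Fin (Module.finrank ℝ D) ⊕ Fin (Module.finrank ℝ Dᗮ)) ℝ V :=
  OrthonormalBasis.mk (v := Sum.elim (fun i ↦ (stdOrthonormalBasis ℝ D i : V))
      (fun j ↦ (stdOrthonormalBasis ℝ Dᗮ j : V)))
    (by
      have h1 := orthonormal_iff_ite.1 (stdOrthonormalBasis ℝ D).orthonormal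
      have h2 := orthonormal_iff_ite.1 (stdOrthonormalBasis ℝ Dᗮ).orthonormal
      rw [orthonormal_iff_ite]
      rintro (i | i) (j | j)
      · simpa using h1 i j
      · simpa using Submodule.inner_right_of_mem_orthogonal
          (stdOrthonormalBasis ℝ D i).2 (stdOrthonormalBasis ℝ Dᗮ j).2
      · simpa using Submodule.inner_left_of_mem_orthogonal
          (stdOrthonormalBasis ℝ D j).2 (stdOrthonormalBasis ℝ Dᗮ i).2
      · simpa using h2 i j)
    (by
      have h : ∀ D' : Submodule ℝ V,
          Submodule.span ℝ (range fun i ↦ (stdOrthonormalBasis ℝ D' i : V)) = D' := by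
        intro D'
        have h1 := (stdOrthonormalBasis ℝ D').toBasis.span_eq
        have h2 := congrArg (Submodule.map D'.subtype) h1
        rw [Submodule.map_span, ← range_comp, Submodule.map_top, Submodule.range_subtype,
          OrthonormalBasis.coe_toBasis] at h2
        exact h2
      rw [Sum.elim_range, Submodule.span_union, h, h, Submodule.sup_orthogonal_of_hasOrthogonalProjection])

theorem adaptedBasis_inl (D : Submodule ℝ V) (i) :
    adaptedBasis D (Sum.inl i) = stdOrthonormalBasis ℝ D i := by
  simp [adaptedBasis]

theorem adaptedBasis_inr (D : Submodule ℝ V) (i) :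
    adaptedBasis D (Sum.inr i) = stdOrthonormalBasis ℝ Dᗮ i := by
  simp [adaptedBasis]

variable {W : Type*} [NormedAddCommGroup W] [InnerProductSpace ℝ W]

theorem eq_zero_on_submodule {D : Submodule ℝ V} {B : V →ₗ[ℝ] V →ₗ[ℝ] W}
    (h : ∑ i, ∑ j, ⟪B (stdOrthonormalBasis ℝ D i) (stdOrthonormalBasis ℝ D j),
      B (stdOrthonormalBasis ℝ D i) (stdOrthonormalBasis ℝ D j)⟫ = 0) {u v : V} (hu : u ∈ D)
    (hv : v ∈ D) : B u v = 0 := by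
  have h1 : ∀ i j, B (stdOrthonormalBasis ℝ D i) (stdOrthonormalBasis ℝ D j) = 0 := by
    intro i j
    have h2 := (Finset.sum_eq_zero_iff_of_nonneg (fun i _ ↦ Finset.sum_nonneg fun j _ ↦
      real_inner_self_nonneg)).1 h i (Finset.mem_univ i)
    have h3 := (Finset.sum_eq_zero_iff_of_nonneg (fun j _ ↦
      real_inner_self_nonneg)).1 h2 j (Finset.mem_univ j)
    exact inner_self_eq_zero.1 h3
  have hs : ∀ w ∈ D, w = ∑ i, ⟪(stdOrthonormalBasis ℝ D i : V), w⟫ •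
      (stdOrthonormalBasis ℝ D i : V) := by
    intro w hw
    have := congrArg (Submodule.subtype D) ((stdOrthonormalBasis ℝ D).sum_repr' ⟨w, hw⟩)
    simpa using this.symm
  rw [hs u hu, hs v hv]
  simp [h1]

theorem sq_inner_div_add_le {h a b : W} {A B : ℝ} (hA : ⟪a, a⟫ = A) (hB : ⟪b, b⟫ = B)
    (hab : ⟪a, b⟫ = 0) (hA0 : 0 < A) (hB0 : 0 < B) :
    ⟪h, a⟫ ^ 2 / A + ⟪h, b⟫ ^ 2 / B ≤ ⟪h, h⟫ := by
  have h0 : 0 ≤ ⟪h - (⟪h, a⟫ / A) • a - (⟪h, b⟫ / B) • b,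
    h - (⟪h, a⟫ / A) • a - (⟪h, b⟫ / B) • b⟫ := real_inner_self_nonneg
  simp only [inner_sub_left, inner_sub_right, real_inner_smul_left, real_inner_smul_right, hA, hB,
    hab, real_inner_comm h, real_inner_comm a b] at h0
  have e : ⟪h, a⟫ / A * (⟪h, a⟫ / A * A) = ⟪h, a⟫ ^ 2 / A := by field_simp
  have e' : ⟪h, b⟫ / B * (⟪h, b⟫ / B * B) = ⟪h, b⟫ ^ 2 / B := by field_simp
  rw [e, e'] at h0
  have e1 : ⟪h, a⟫ / A * ⟪h, a⟫ = ⟪h, a⟫ ^ 2 / A := by ring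
  have e2 : ⟪h, b⟫ / B * ⟪h, b⟫ = ⟪h, b⟫ ^ 2 / B := by ring
  rw [e1, e2] at h0
  linarith

/-- The algebraic data of a warped product semi-slant submanifold of a nearly Kaehler manifold at
a point: `L` is the differential of the immersion, `D` the holomorphic distribution, `P` the
tangential part of `J` on the slant distribution, `c` and `s` are the cosine and the sine of the
slant angle, `h` is the second fundamental form and `G` the gradient of the logarithm of the
warping function. -/
structure SemiSlantData (L : V →ₗ[ℝ] W) (J : W →ₗ[ℝ] W) (D : Submodule ℝ V) (P : V → V)
    (h : V →ₗ[ℝ] V →ₗ[ℝ] W) (G : V) (c s : ℝ) : Prop where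
  inner_map : ∀ u v, ⟪L u, L v⟫ = ⟪u, v⟫
  inner_J : ∀ u v, ⟪J u, J v⟫ = ⟪u, v⟫
  J_sq : ∀ u, J (J u) = -u
  J_mem : ∀ X ∈ D, ∃ X' ∈ D, L X' = J (L X)
  P_mem : ∀ Z ∈ Dᗮ, P Z ∈ Dᗮ
  inner_P : ∀ Z ∈ Dᗮ, ∀ v, ⟪J (L Z), L v⟫ = ⟪P Z, v⟫
  norm_P : ∀ Z ∈ Dᗮ, ⟪P Z, P Z⟫ = c ^ 2 * ⟪Z, Z⟫
  c_ne : c ≠ 0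
  s_ne : s ≠ 0
  sq_add_sq : s ^ 2 + c ^ 2 = 1
  G_mem : G ∈ D
  h_normal : ∀ u v w, ⟪h u v, L w⟫ = 0
  h_comm : ∀ u v, h u v = h v u
  inner_h_J : ∀ X ∈ D, ∀ Z ∈ Dᗮ, ⟪h X Z, J (L Z)⟫ = -⟪J (L X), L G⟫ * ⟪Z, Z⟫
  inner_h_JP : ∀ X ∈ D, ∀ Z ∈ Dᗮ, 3 * ⟪h X Z, J (L (P Z))⟫ = c ^ 2 * ⟪G, X⟫ * ⟪Z, Z⟫

namespace SemiSlantData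

variable {L : V →ₗ[ℝ] W} {J : W →ₗ[ℝ] W} {D : Submodule ℝ V} {P : V → V}
    {h : V →ₗ[ℝ] V →ₗ[ℝ] W} {G : V} {c s : ℝ}

theorem inner_J_left (H : SemiSlantData L J D P h G c s) (u v : W) : ⟪J u, v⟫ = -⟪u, J v⟫ := by
  rw [← H.inner_J (J u) v, H.J_sq, inner_neg_left]

theorem inner_J_self (H : SemiSlantData L J D P h G c s) (u : W) : ⟪J u, u⟫ = 0 := by
  have := H.inner_J_left u u
  rw [real_inner_comm] at this
  linarith [real_inner_comm u (J u)]

theorem le_norm_mixed (H : SemiSlantData L J D P h G c s) {X Z : V} (hX : X ∈ D) (hZ : Z ∈ Dᗮ)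
    (hZ1 : ⟪Z, Z⟫ = 1) :
    ⟪J (L X), L G⟫ ^ 2 / s ^ 2 + ⟪G, X⟫ ^ 2 * (c ^ 2 / (9 * s ^ 2)) ≤ ⟪h X Z, h X Z⟫ := by
  have hc := H.c_ne
  have hs := H.s_ne
  have hPZ := H.P_mem Z hZ
  have h1 : ⟪J (L Z) - L (P Z), J (L Z) - L (P Z)⟫ = s ^ 2 := by
    rw [inner_sub_left, inner_sub_right, inner_sub_right, H.inner_J, H.inner_map, H.inner_map,
      H.inner_P Z hZ, real_inner_comm (J (L Z)), H.inner_P Z hZ, H.norm_P Z hZ, hZ1]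
    linarith [H.sq_add_sq]
  have h2 : ⟪J (L (P Z)) - L (P (P Z)), J (L (P Z)) - L (P (P Z))⟫ = c ^ 2 * s ^ 2 := by
    rw [inner_sub_left, inner_sub_right, inner_sub_right, H.inner_J, H.inner_map, H.inner_map,
      H.inner_P _ hPZ, real_inner_comm (J (L (P Z))), H.inner_P _ hPZ, H.norm_P _ hPZ,
      H.norm_P Z hZ, hZ1]
    linear_combination (-c ^ 2) * H.sq_add_sq
  have h3 : ⟪J (L Z) - L (P Z), J (L (P Z)) - L (P (P Z))⟫ = 0 := by
    have e1 : ⟪Z, P Z⟫ = 0 := by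
      rw [real_inner_comm, ← H.inner_P Z hZ, H.inner_J_self]
    have e2 : ⟪P Z, P (P Z)⟫ = 0 := by
      rw [real_inner_comm, ← H.inner_P _ hPZ, H.inner_J_self]
    rw [inner_sub_left, inner_sub_right, inner_sub_right, H.inner_J, H.inner_map, H.inner_map,
      H.inner_P Z hZ, real_inner_comm (J (L (P Z))), H.inner_J_self, e1, e2]
    ring
  have h4 := sq_inner_div_add_le (h := h X Z) h1 h2 h3 (by positivity) (by positivity)
  have h5 : ⟪h X Z, J (L Z) - L (P Z)⟫ = -⟪J (L X), L G⟫ := by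
    rw [inner_sub_right, H.h_normal, H.inner_h_J X hX Z hZ, hZ1]
    ring
  have h6 : ⟪h X Z, J (L (P Z)) - L (P (P Z))⟫ = c ^ 2 * ⟪G, X⟫ / 3 := by
    have := H.inner_h_JP X hX Z hZ
    rw [inner_sub_right, H.h_normal, sub_zero]
    rw [hZ1] at this
    linarith
  rw [h5, h6] at h4
  refine le_trans (le_of_eq ?_) h4
  field_simp
  ring

theorem sum_mixed (H : SemiSlantData L J D P h G c s) :
    Module.finrank ℝ Dᗮ * ((1 / s) ^ 2 + 1 / 9 * (c / s) ^ 2) * ‖G‖ ^ 2 ≤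
      ∑ i, ∑ j, ⟪h (stdOrthonormalBasis ℝ D i) (stdOrthonormalBasis ℝ Dᗮ j),
        h (stdOrthonormalBasis ℝ D i) (stdOrthonormalBasis ℝ Dᗮ j)⟫ := by
  have hs : ∀ v ∈ D, ∑ i, ⟪v, (stdOrthonormalBasis ℝ D i : V)⟫ ^ 2 = ‖v‖ ^ 2 := by
    intro v hv
    have := (stdOrthonormalBasis ℝ D).sum_sq_norm_inner_left ⟨v, hv⟩
    simpa using this
  have h1 : ∑ i, ⟪J (L (stdOrthonormalBasis ℝ D i)), L G⟫ ^ 2 = ‖G‖ ^ 2 := by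
    obtain ⟨G', hG', hLG⟩ := H.J_mem G H.G_mem
    have h2 : ∀ i, ⟪J (L (stdOrthonormalBasis ℝ D i)), L G⟫ ^ 2 =
        ⟪G', (stdOrthonormalBasis ℝ D i : V)⟫ ^ 2 := by
      intro i
      rw [H.inner_J_left, ← hLG, H.inner_map, real_inner_comm, neg_sq]
    simp only [h2]
    rw [hs G' hG', ← real_inner_self_eq_norm_sq, ← real_inner_self_eq_norm_sq, ← H.inner_map,
      hLG, H.inner_J, H.inner_map]
  have h3 := Finset.sum_le_sum fun i (_ : i ∈ Finset.univ) ↦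
    Finset.sum_le_sum fun j (_ : j ∈ Finset.univ) ↦
      H.le_norm_mixed (stdOrthonormalBasis ℝ D i).2 (stdOrthonormalBasis ℝ Dᗮ j).2
        (by
          have := orthonormal_iff_ite.1 (stdOrthonormalBasis ℝ Dᗮ).orthonormal j j
          rwa [if_pos rfl] at this)
  refine le_trans (le_of_eq ?_) h3
  simp only [Finset.sum_const, Finset.card_univ, Fintype.card_fin, nsmul_eq_mul,
    ← Finset.mul_sum, Finset.sum_add_distrib, ← Finset.sum_div, ← Finset.sum_mul, h1,
    hs G H.G_mem]
  ring

theorem sum_eq (H : SemiSlantData L J D P h G c s) {ι : Type*} [Fintype ι]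
    (e : OrthonormalBasis ι ℝ V) :
    ∑ i, ∑ j, ⟪h (e i) (e j), h (e i) (e j)⟫ =
      (∑ i, ∑ j, ⟪h (stdOrthonormalBasis ℝ D i) (stdOrthonormalBasis ℝ D j),
        h (stdOrthonormalBasis ℝ D i) (stdOrthonormalBasis ℝ D j)⟫)
      + 2 * (∑ i, ∑ j, ⟪h (stdOrthonormalBasis ℝ D i) (stdOrthonormalBasis ℝ Dᗮ j),
        h (stdOrthonormalBasis ℝ D i) (stdOrthonormalBasis ℝ Dᗮ j)⟫)
      + ∑ i, ∑ j, ⟪h (stdOrthonormalBasis ℝ Dᗮ i) (stdOrthonormalBasis ℝ Dᗮ j),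
        h (stdOrthonormalBasis ℝ Dᗮ i) (stdOrthonormalBasis ℝ Dᗮ j)⟫ := by
  rw [sum_sq_orthonormalBasis_eq e (adaptedBasis D)]
  simp only [Fintype.sum_sum_type, adaptedBasis_inl, adaptedBasis_inr, Finset.sum_add_distrib]
  have hsw : ∑ i, ∑ j, ⟪h (stdOrthonormalBasis ℝ Dᗮ i) (stdOrthonormalBasis ℝ D j),
        h (stdOrthonormalBasis ℝ Dᗮ i) (stdOrthonormalBasis ℝ D j)⟫ =
      ∑ i, ∑ j, ⟪h (stdOrthonormalBasis ℝ D i) (stdOrthonormalBasis ℝ Dᗮ j),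
        h (stdOrthonormalBasis ℝ D i) (stdOrthonormalBasis ℝ Dᗮ j)⟫ := by
    rw [Finset.sum_comm]
    simp only [H.h_comm]
  rw [hsw]
  ring

theorem le_sum (H : SemiSlantData L J D P h G c s) {ι : Type*} [Fintype ι]
    (e : OrthonormalBasis ι ℝ V) :
    2 * Module.finrank ℝ Dᗮ * ((1 / s) ^ 2 + 1 / 9 * (c / s) ^ 2) * ‖G‖ ^ 2 ≤
      ∑ i, ∑ j, ⟪h (e i) (e j), h (e i) (e j)⟫ := by
  have h0 : ∀ {κ μ : Type} [Fintype κ] [Fintype μ] (B : κ → μ → W),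
      0 ≤ ∑ i, ∑ j, ⟪B i j, B i j⟫ := fun B ↦
    Finset.sum_nonneg fun i _ ↦ Finset.sum_nonneg fun j _ ↦ real_inner_self_nonneg
  rw [H.sum_eq e]
  linarith [H.sum_mixed, h0 fun i j ↦ h (stdOrthonormalBasis ℝ D i) (stdOrthonormalBasis ℝ D j),
    h0 fun i j ↦ h (stdOrthonormalBasis ℝ Dᗮ i) (stdOrthonormalBasis ℝ Dᗮ j)]

theorem eq_zero_of_sum_eq (H : SemiSlantData L J D P h G c s) {ι : Type*} [Fintype ι]
    (e : OrthonormalBasis ι ℝ V)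
    (he : ∑ i, ∑ j, ⟪h (e i) (e j), h (e i) (e j)⟫ =
      2 * Module.finrank ℝ Dᗮ * ((1 / s) ^ 2 + 1 / 9 * (c / s) ^ 2) * ‖G‖ ^ 2) :
    (∀ X ∈ D, ∀ Y ∈ D, h X Y = 0) ∧ ∀ Z ∈ Dᗮ, ∀ Z' ∈ Dᗮ, h Z Z' = 0 := by
  have h0 : ∀ {κ μ : Type} [Fintype κ] [Fintype μ] (B : κ → μ → W),
      0 ≤ ∑ i, ∑ j, ⟪B i j, B i j⟫ := fun B ↦
    Finset.sum_nonneg fun i _ ↦ Finset.sum_nonneg fun j _ ↦ real_inner_self_nonneg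
  rw [H.sum_eq e] at he
  have h1 := h0 fun i j ↦ h (stdOrthonormalBasis ℝ D i) (stdOrthonormalBasis ℝ D j)
  have h2 := h0 fun i j ↦ h (stdOrthonormalBasis ℝ Dᗮ i) (stdOrthonormalBasis ℝ Dᗮ j)
  have h3 := H.sum_mixed
  exact ⟨fun X hX Y hY ↦ eq_zero_on_submodule (by linarith) hX hY,
    fun X hX Y hY ↦ eq_zero_on_submodule (by linarith) hX hY⟩

theorem trace_eq_zero_of_sum_eq (H : SemiSlantData L J D P h G c s) {ι : Type*} [Fintype ι]
    (e : OrthonormalBasis ι ℝ V)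
    (he : ∑ i, ∑ j, ⟪h (e i) (e j), h (e i) (e j)⟫ =
      2 * Module.finrank ℝ Dᗮ * ((1 / s) ^ 2 + 1 / 9 * (c / s) ^ 2) * ‖G‖ ^ 2) :
    ∑ i, h (e i) (e i) = 0 := by
  obtain ⟨h1, h2⟩ := H.eq_zero_of_sum_eq e he
  rw [sum_orthonormalBasis_eq e (adaptedBasis D), Fintype.sum_sum_type]
  simp only [adaptedBasis_inl, adaptedBasis_inr]
  rw [Finset.sum_eq_zero fun i _ ↦ h1 _ (stdOrthonormalBasis ℝ D i).2 _
      (stdOrthonormalBasis ℝ D i).2, Finset.sum_eq_zero fun i _ ↦ h2 _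
      (stdOrthonormalBasis ℝ Dᗮ i).2 _ (stdOrthonormalBasis ℝ Dᗮ i).2, add_zero]

end SemiSlantData

end LinearAlgebra

section Product

variable {E₁ : Type*} [NormedAddCommGroup E₁] [NormedSpace ℝ E₁]
  {H₁ : Type*} [TopologicalSpace H₁] {I₁ : ModelWithCorners ℝ E₁ H₁}
  {N₁ : Type*} [TopologicalSpace N₁] [ChartedSpace H₁ N₁] [IsManifold I₁ ∞ N₁]
  {E₂ : Type*} [NormedAddCommGroup E₂] [NormedSpace ℝ E₂]
  {H₂ : Type*} [TopologicalSpace H₂] {I₂ : ModelWithCorners ℝ E₂ H₂}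
  {N₂ : Type*} [TopologicalSpace N₂] [ChartedSpace H₂ N₂] [IsManifold I₂ ∞ N₂]

variable (I₁ I₂) in
/-- The component of a tangent vector of a product along the first factor. -/
def dfst (x : N₁ × N₂) : TangentSpace (I₁.prod I₂) x →L[ℝ] TangentSpace I₁ x.1 :=
  mfderiv (I₁.prod I₂) I₁ Prod.fst x

variable (I₁ I₂) in
/-- The component of a tangent vector of a product along the second factor. -/
def dsnd (x : N₁ × N₂) : TangentSpace (I₁.prod I₂) x →L[ℝ] TangentSpace I₂ x.2 :=
  mfderiv (I₁.prod I₂) I₂ Prod.snd x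

variable (I₁ I₂) in
/-- The inclusion of the tangent space of the first factor. -/
def dinl (x : N₁ × N₂) : TangentSpace I₁ x.1 →L[ℝ] TangentSpace (I₁.prod I₂) x :=
  mfderiv I₁ (I₁.prod I₂) (fun p ↦ (p, x.2)) x.1

variable (I₁ I₂) in
/-- The inclusion of the tangent space of the second factor. -/
def dinr (x : N₁ × N₂) : TangentSpace I₂ x.2 →L[ℝ] TangentSpace (I₁.prod I₂) x :=
  mfderiv I₂ (I₁.prod I₂) (fun q ↦ (x.1, q)) x.2

theorem ext_dfst_dsnd {x : N₁ × N₂} {u v : TangentSpace (I₁.prod I₂) x}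
    (h₁ : dfst I₁ I₂ x u = dfst I₁ I₂ x v) (h₂ : dsnd I₁ I₂ x u = dsnd I₁ I₂ x v) : u = v := by
  unfold dfst at h₁
  unfold dsnd at h₂
  rw [mfderiv_fst] at h₁
  rw [mfderiv_snd] at h₂
  exact Prod.ext h₁ h₂

theorem dfst_dinl (x : N₁ × N₂) (X : TangentSpace I₁ x.1) :
    dfst I₁ I₂ x (dinl I₁ I₂ x X) = X := by
  unfold dfst dinl
  rw [mfderiv_fst, mfderiv_prod_left]
  rfl

theorem dsnd_dinl (x : N₁ × N₂) (X : TangentSpace I₁ x.1) :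
    dsnd I₁ I₂ x (dinl I₁ I₂ x X) = 0 := by
  unfold dsnd dinl
  rw [mfderiv_snd, mfderiv_prod_left]
  rfl

theorem dfst_dinr (x : N₁ × N₂) (Z : TangentSpace I₂ x.2) :
    dfst I₁ I₂ x (dinr I₁ I₂ x Z) = 0 := by
  unfold dfst dinr
  rw [mfderiv_fst, mfderiv_prod_right]
  rfl

theorem dsnd_dinr (x : N₁ × N₂) (Z : TangentSpace I₂ x.2) :
    dsnd I₁ I₂ x (dinr I₁ I₂ x Z) = Z := by
  unfold dsnd dinr
  rw [mfderiv_snd, mfderiv_prod_right]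
  rfl

theorem dinl_dfst {x : N₁ × N₂} {u : TangentSpace (I₁.prod I₂) x} (h : dsnd I₁ I₂ x u = 0) :
    dinl I₁ I₂ x (dfst I₁ I₂ x u) = u :=
  ext_dfst_dsnd (dfst_dinl x _) ((dsnd_dinl x _).trans h.symm)

theorem dinr_dsnd {x : N₁ × N₂} {u : TangentSpace (I₁.prod I₂) x} (h : dfst I₁ I₂ x u = 0) :
    dinr I₁ I₂ x (dsnd I₁ I₂ x u) = u :=
  ext_dfst_dsnd ((dfst_dinr x _).trans h.symm) (dsnd_dinr x _)

theorem dinl_add_dinr {x : N₁ × N₂} (u : TangentSpace (I₁.prod I₂) x) :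
    dinl I₁ I₂ x (dfst I₁ I₂ x u) + dinr I₁ I₂ x (dsnd I₁ I₂ x u) = u := by
  refine ext_dfst_dsnd ?_ ?_
  · rw [map_add, dfst_dinl, dfst_dinr, add_zero]
  · rw [map_add, dsnd_dinl, dsnd_dinr, zero_add]

theorem mem_chart_source_prod {x₀ x : N₁ × N₂}
    (hx : x ∈ (chartAt (ModelProd H₁ H₂) x₀).source) :
    x.1 ∈ (chartAt H₁ x₀.1).source ∧ x.2 ∈ (chartAt H₂ x₀.2).source := by
  simpa [prodChartedSpace_chartAt] using hx

theorem comps_prod_fst {x₀ x : N₁ × N₂} (hx : x ∈ (chartAt (ModelProd H₁ H₂) x₀).source)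
    (u : TangentSpace (I₁.prod I₂) x) :
    (comps (I₁.prod I₂) x₀ x u).1 = comps I₁ x₀.1 x.1 (dfst I₁ I₂ x u) := by
  obtain ⟨h1, h2⟩ := mem_chart_source_prod hx
  have e1 := mvfderiv_comp_vec (mdifferentiableAt_extChartAt h1)
    (mdifferentiableAt_fst (I := I₁) (I' := I₂) (x := x)) u
  have e2 := mvfderiv_comp_extChartAt (I := I₁.prod I₂) hx
    (differentiableAt_fst (𝕜 := ℝ) (E := E₁) (F := E₂)) u
  rw [fderiv_fst] at e2
  have e3 : (fun z : N₁ × N₂ ↦ Prod.fst (extChartAt (I₁.prod I₂) x₀ z)) =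
      fun z ↦ extChartAt I₁ x₀.1 z.1 := by
    ext z
    rw [extChartAt_prod]
    rfl
  rw [e3, e1] at e2
  rw [comps_eq_mfderiv h1]
  exact e2.symm

theorem comps_prod_snd {x₀ x : N₁ × N₂} (hx : x ∈ (chartAt (ModelProd H₁ H₂) x₀).source)
    (u : TangentSpace (I₁.prod I₂) x) :
    (comps (I₁.prod I₂) x₀ x u).2 = comps I₂ x₀.2 x.2 (dsnd I₁ I₂ x u) := by
  obtain ⟨h1, h2⟩ := mem_chart_source_prod hx
  have e1 := mvfderiv_comp_vec (mdifferentiableAt_extChartAt h2)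
    (mdifferentiableAt_snd (I := I₁) (I' := I₂) (x := x)) u
  have e2 := mvfderiv_comp_extChartAt (I := I₁.prod I₂) hx
    (differentiableAt_snd (𝕜 := ℝ) (E := E₁) (F := E₂)) u
  rw [fderiv_snd] at e2
  have e3 : (fun z : N₁ × N₂ ↦ Prod.snd (extChartAt (I₁.prod I₂) x₀ z)) =
      fun z ↦ extChartAt I₂ x₀.2 z.2 := by
    ext z
    rw [extChartAt_prod]
    rfl
  rw [e3, e1] at e2
  rw [comps_eq_mfderiv h2]
  exact e2.symm

theorem dfst_extend {x₀ x : N₁ × N₂} (hx : x ∈ (chartAt (ModelProd H₁ H₂) x₀).source)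
    (u : TangentSpace (I₁.prod I₂) x₀) :
    dfst I₁ I₂ x (FiberBundle.extend (E₁ × E₂) u x) =
      FiberBundle.extend E₁ (dfst I₁ I₂ x₀ u) x.1 := by
  obtain ⟨h1, h2⟩ := mem_chart_source_prod hx
  refine comps_injective h1 ?_
  rw [comps_extend h1, ← comps_prod_fst hx, comps_extend hx,
    comps_prod_fst (mem_chart_source _ x₀)]

theorem dsnd_extend {x₀ x : N₁ × N₂} (hx : x ∈ (chartAt (ModelProd H₁ H₂) x₀).source)
    (u : TangentSpace (I₁.prod I₂) x₀) :
    dsnd I₁ I₂ x (FiberBundle.extend (E₁ × E₂) u x) =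
      FiberBundle.extend E₂ (dsnd I₁ I₂ x₀ u) x.2 := by
  obtain ⟨h1, h2⟩ := mem_chart_source_prod hx
  refine comps_injective h2 ?_
  rw [comps_extend h2, ← comps_prod_snd hx, comps_extend hx,
    comps_prod_snd (mem_chart_source _ x₀)]

theorem extend_zero {x₀ x : N₁} (hx : x ∈ (chartAt H₁ x₀).source) :
    FiberBundle.extend E₁ (0 : TangentSpace I₁ x₀) x = 0 := by
  rw [extend_eq_ofComps 0 hx, map_zero, map_zero]

end Product

section Log

variable {E : Type*} [NormedAddCommGroup E] [NormedSpace ℝ E]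
  {H : Type*} [TopologicalSpace H] {I : ModelWithCorners ℝ E H} [I.Boundaryless]
  {N : Type*} [TopologicalSpace N] [ChartedSpace H N] [IsManifold I ∞ N]

theorem mul_mvfderiv_log {g : N → ℝ} {y : N} (hg : MDifferentiableAt I 𝓘(ℝ, ℝ) g y)
    (h0 : g y ≠ 0) (u : TangentSpace I y) :
    g y * mvfderiv I (fun z ↦ Real.log (g z)) y u = mvfderiv I g y u := by
  have hl : MDifferentiableAt I 𝓘(ℝ, ℝ) (fun z ↦ Real.log (g z)) y :=
    MDifferentiableAt.comp y (Real.differentiableAt_log h0).mdifferentiableAt hg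
  have hy : (g ∘ (extChartAt I y).symm) (extChartAt I y y) = g y := by simp
  have h := ((differentiableAt_comp_extChartAt_symm hg).hasFDerivAt.log (by rwa [hy])).fderiv
  rw [mvfderiv_eq_fderiv hl, mvfderiv_eq_fderiv hg]
  have h' := congrArg (fun A : E →L[ℝ] ℝ ↦ g y * A (comps I y y u)) h
  refine h'.trans ?_
  simp only [smul_apply, smul_eq_mul]
  rw [hy, mul_inv_cancel_left₀ h0]

end Log

section Warped

variable {E₁ : Type*} [NormedAddCommGroup E₁] [NormedSpace ℝ E₁] [FiniteDimensional ℝ E₁]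
  {H₁ : Type*} [TopologicalSpace H₁] {I₁ : ModelWithCorners ℝ E₁ H₁} [I₁.Boundaryless]
  {N₁ : Type*} [TopologicalSpace N₁] [ChartedSpace H₁ N₁] [IsManifold I₁ ∞ N₁]
  [RiemannianBundle (fun p : N₁ ↦ TangentSpace I₁ p)]
  [IsContMDiffRiemannianBundle I₁ ∞ E₁ (fun p : N₁ ↦ TangentSpace I₁ p)]
  {E₂ : Type*} [NormedAddCommGroup E₂] [NormedSpace ℝ E₂] [FiniteDimensional ℝ E₂]
  {H₂ : Type*} [TopologicalSpace H₂] {I₂ : ModelWithCorners ℝ E₂ H₂} [I₂.Boundaryless]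
  {N₂ : Type*} [TopologicalSpace N₂] [ChartedSpace H₂ N₂] [IsManifold I₂ ∞ N₂]
  [RiemannianBundle (fun q : N₂ ↦ TangentSpace I₂ q)]
  [IsContMDiffRiemannianBundle I₂ ∞ E₂ (fun q : N₂ ↦ TangentSpace I₂ q)]
  [RiemannianBundle (fun x : N₁ × N₂ ↦ TangentSpace (I₁.prod I₂) x)]
  {f : N₁ → ℝ}

theorem IsWarpedProduct.inner_eq_dfst_dsnd (hM : IsWarpedProduct I₁ I₂ (N₁ := N₁) (N₂ := N₂) f)
    (x : N₁ × N₂) (u v : TangentSpace (I₁.prod I₂) x) :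
    ⟪u, v⟫ = ⟪dfst I₁ I₂ x u, dfst I₁ I₂ x v⟫ +
      f x.1 ^ 2 * ⟪dsnd I₁ I₂ x u, dsnd I₁ I₂ x v⟫ :=
  hM.inner_eq x u v

/-- The derivative of the warped metric in coordinates. -/
theorem IsWarpedProduct.mvfderiv_inner_extend
    (hM : IsWarpedProduct I₁ I₂ (N₁ := N₁) (N₂ := N₂) f)
    {x : N₁ × N₂} (u v w : TangentSpace (I₁.prod I₂) x) :
    mvfderiv (I₁.prod I₂) (fun z ↦ ⟪FiberBundle.extend (E₁ × E₂) v z,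
        FiberBundle.extend (E₁ × E₂) w z⟫) x u =
      mvfderiv I₁ (fun p ↦ ⟪FiberBundle.extend E₁ (dfst I₁ I₂ x v) p,
        FiberBundle.extend E₁ (dfst I₁ I₂ x w) p⟫) x.1 (dfst I₁ I₂ x u)
      + 2 * f x.1 * mvfderiv I₁ f x.1 (dfst I₁ I₂ x u) * ⟪dsnd I₁ I₂ x v, dsnd I₁ I₂ x w⟫
      + f x.1 ^ 2 * mvfderiv I₂ (fun q ↦ ⟪FiberBundle.extend E₂ (dsnd I₁ I₂ x v) q,
        FiberBundle.extend E₂ (dsnd I₁ I₂ x w) q⟫) x.2 (dsnd I₁ I₂ x u) := by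
  have hA : MDifferentiableAt I₁ 𝓘(ℝ, ℝ) (fun p ↦ ⟪FiberBundle.extend E₁ (dfst I₁ I₂ x v) p,
        FiberBundle.extend E₁ (dfst I₁ I₂ x w) p⟫) x.1 :=
    mdifferentiableAt_inner_of_diffAlong (φ := fun p : N₁ ↦ p) mdifferentiableAt_id
      (diffAlong_extend _) (diffAlong_extend _)
  have hB : MDifferentiableAt I₂ 𝓘(ℝ, ℝ) (fun q ↦ ⟪FiberBundle.extend E₂ (dsnd I₁ I₂ x v) q,
        FiberBundle.extend E₂ (dsnd I₁ I₂ x w) q⟫) x.2 :=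
    mdifferentiableAt_inner_of_diffAlong (φ := fun q : N₂ ↦ q) mdifferentiableAt_id
      (diffAlong_extend _) (diffAlong_extend _)
  have hf : MDifferentiableAt I₁ 𝓘(ℝ, ℝ) f x.1 := hM.contMDiff.mdifferentiable (by simp) _
  have h1 := mdifferentiableAt_fst (I := I₁) (I' := I₂) (x := x)
  have h2 := mdifferentiableAt_snd (I := I₁) (I' := I₂) (x := x)
  have hA' := MDifferentiableAt.comp x hA h1
  have hB' := MDifferentiableAt.comp x hB h2
  have hf' := MDifferentiableAt.comp x hf h1
  have key : (fun z ↦ ⟪FiberBundle.extend (E₁ × E₂) v z, FiberBundle.extend (E₁ × E₂) w z⟫)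
      =ᶠ[𝓝 x]
      ((fun p ↦ ⟪FiberBundle.extend E₁ (dfst I₁ I₂ x v) p,
        FiberBundle.extend E₁ (dfst I₁ I₂ x w) p⟫) ∘ Prod.fst) +
      ((f ∘ Prod.fst) * (f ∘ Prod.fst)) * ((fun q ↦ ⟪FiberBundle.extend E₂ (dsnd I₁ I₂ x v) q,
        FiberBundle.extend E₂ (dsnd I₁ I₂ x w) q⟫) ∘ Prod.snd) := by
    filter_upwards [eventually_mem_chart_source (H := ModelProd H₁ H₂) x] with z hz
    rw [hM.inner_eq_dfst_dsnd, dfst_extend hz, dfst_extend hz, dsnd_extend hz, dsnd_extend hz]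
    simp [pow_two]
  rw [mvfderiv_congr key, mvfderiv_add hA' ((hf'.mul hf').mul hB'), add_apply,
    mvfderiv_mul (hf'.mul hf') hB', mvfderiv_mul hf' hf']
  simp only [add_apply, smul_apply, smul_eq_mul]
  have e1 := mvfderiv_comp_vec hA h1 u
  have e2 := mvfderiv_comp_vec hB h2 u
  have e3 := mvfderiv_comp_vec hf h1 u
  simp only [Function.comp_def, Pi.mul_apply, FiberBundle.extend_apply_self]
  rw [e1, e2, e3]
  unfold dfst dsnd
  ring

variable {E : Type*} [NormedAddCommGroup E] [NormedSpace ℝ E] [FiniteDimensional ℝ E]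
  {H : Type*} [TopologicalSpace H] {I : ModelWithCorners ℝ E H} [I.Boundaryless]
  {N : Type*} [TopologicalSpace N] [ChartedSpace H N] [IsManifold I ∞ N]
  [RiemannianBundle (fun y : N ↦ TangentSpace I y)]
  [IsContMDiffRiemannianBundle I ∞ E (fun y : N ↦ TangentSpace I y)]
  {φ : N₁ × N₂ → N}

theorem mvfderiv_inner_extend_zero_left {x : N₁} (v u : TangentSpace I₁ x) :
    mvfderiv I₁ (fun p ↦ ⟪FiberBundle.extend E₁ (0 : TangentSpace I₁ x) p,
        FiberBundle.extend E₁ v p⟫) x u = 0 := by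
  have h : (fun p ↦ ⟪FiberBundle.extend E₁ (0 : TangentSpace I₁ x) p,
        FiberBundle.extend E₁ v p⟫) =ᶠ[𝓝 x] fun _ ↦ (0 : ℝ) := by
    filter_upwards [eventually_mem_chart_source (H := H₁) x] with z hz
    rw [extend_zero hz, inner_zero_left]
  rw [mvfderiv_congr h, mvfderiv_const, zero_apply]

theorem mvfderiv_inner_extend_zero_right {x : N₁} (v u : TangentSpace I₁ x) :
    mvfderiv I₁ (fun p ↦ ⟪FiberBundle.extend E₁ v p,
        FiberBundle.extend E₁ (0 : TangentSpace I₁ x) p⟫) x u = 0 := by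
  rw [← mvfderiv_inner_extend_zero_left v u]
  simp only [real_inner_comm]

theorem mvfderiv_inner_immersion (hM : IsWarpedProduct I₁ I₂ (N₁ := N₁) (N₂ := N₂) f)
    (hφ : IsIsometricImmersion (I₁.prod I₂) I φ) {x : N₁ × N₂}
    (u v w : TangentSpace (I₁.prod I₂) x) :
    mvfderiv (I₁.prod I₂) (fun z ↦
        ⟪mfderiv (I₁.prod I₂) I φ z (FiberBundle.extend (E₁ × E₂) v z),
        mfderiv (I₁.prod I₂) I φ z (FiberBundle.extend (E₁ × E₂) w z)⟫) x u =
      mvfderiv I₁ (fun p ↦ ⟪FiberBundle.extend E₁ (dfst I₁ I₂ x v) p,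
        FiberBundle.extend E₁ (dfst I₁ I₂ x w) p⟫) x.1 (dfst I₁ I₂ x u)
      + 2 * f x.1 * mvfderiv I₁ f x.1 (dfst I₁ I₂ x u) * ⟪dsnd I₁ I₂ x v, dsnd I₁ I₂ x w⟫
      + f x.1 ^ 2 * mvfderiv I₂ (fun q ↦ ⟪FiberBundle.extend E₂ (dsnd I₁ I₂ x v) q,
        FiberBundle.extend E₂ (dsnd I₁ I₂ x w) q⟫) x.2 (dsnd I₁ I₂ x u) := by
  simp only [hφ.inner_mfderiv]
  exact hM.mvfderiv_inner_extend u v w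

theorem mvfderiv_log_comp_fst (hM : IsWarpedProduct I₁ I₂ (N₁ := N₁) (N₂ := N₂) f)
    {x : N₁ × N₂} (u : TangentSpace (I₁.prod I₂) x) :
    f x.1 * mvfderiv (I₁.prod I₂) (fun x : N₁ × N₂ ↦ Real.log (f x.1)) x u =
      mvfderiv I₁ f x.1 (dfst I₁ I₂ x u) := by
  have hf : MDifferentiableAt I₁ 𝓘(ℝ, ℝ) f x.1 := hM.contMDiff.mdifferentiable (by simp) _
  have h1 := mdifferentiableAt_fst (I := I₁) (I' := I₂) (x := x)
  exact (mul_mvfderiv_log (g := fun z : N₁ × N₂ ↦ f z.1) (MDifferentiableAt.comp x hf h1)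
    (hM.pos _).ne' u).trans (mvfderiv_comp_vec hf h1 u)

section Hess

variable (hM : IsWarpedProduct I₁ I₂ (N₁ := N₁) (N₂ := N₂) f)
  (hφ : IsIsometricImmersion (I₁.prod I₂) I φ) {x : N₁ × N₂}

include hM hφ

theorem inner_hess_mixed_fst {X Y Z : TangentSpace (I₁.prod I₂) x} (hX : dsnd I₁ I₂ x X = 0)
    (hY : dsnd I₁ I₂ x Y = 0) (hZ : dfst I₁ I₂ x Z = 0) :
    ⟪hess (I₁.prod I₂) I φ x X Z, mfderiv (I₁.prod I₂) I φ x Y⟫ = 0 := by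
  have h := inner_hess hφ.contMDiff X Z Y
  simp only [mvfderiv_inner_immersion hM hφ, hX, hY, hZ, mvfderiv_inner_extend_zero_left,
    mvfderiv_inner_extend_zero_right, inner_zero_left, inner_zero_right, map_zero] at h
  linarith

theorem inner_hess_fst_fst {X Y Z : TangentSpace (I₁.prod I₂) x} (hX : dsnd I₁ I₂ x X = 0)
    (hY : dsnd I₁ I₂ x Y = 0) (hZ : dfst I₁ I₂ x Z = 0) :
    ⟪hess (I₁.prod I₂) I φ x X Y, mfderiv (I₁.prod I₂) I φ x Z⟫ = 0 := by
  have h := inner_hess hφ.contMDiff X Y Z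
  simp only [mvfderiv_inner_immersion hM hφ, hX, hY, hZ, mvfderiv_inner_extend_zero_left,
    mvfderiv_inner_extend_zero_right, inner_zero_left, inner_zero_right, map_zero] at h
  linarith

theorem mvfderiv_inner_snd {X Z W : TangentSpace (I₁.prod I₂) x} (hX : dsnd I₁ I₂ x X = 0)
    (hZ : dfst I₁ I₂ x Z = 0) (hW : dfst I₁ I₂ x W = 0) :
    mvfderiv (I₁.prod I₂) (fun z ↦
        ⟪mfderiv (I₁.prod I₂) I φ z (FiberBundle.extend (E₁ × E₂) Z z),
        mfderiv (I₁.prod I₂) I φ z (FiberBundle.extend (E₁ × E₂) W z)⟫) x X =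
      2 * mvfderiv (I₁.prod I₂) (fun x : N₁ × N₂ ↦ Real.log (f x.1)) x X * ⟪Z, W⟫ := by
  have h := hM.inner_eq_dfst_dsnd x Z W
  have h' := mvfderiv_log_comp_fst hM X
  simp only [hZ, hW, inner_zero_left, zero_add] at h
  simp only [mvfderiv_inner_immersion hM hφ, hX, hZ, hW, mvfderiv_inner_extend_zero_left,
    map_zero]
  rw [h, ← h']
  ring

theorem inner_hess_mixed_snd {X Z W : TangentSpace (I₁.prod I₂) x} (hX : dsnd I₁ I₂ x X = 0)
    (hZ : dfst I₁ I₂ x Z = 0) (hW : dfst I₁ I₂ x W = 0) :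
    ⟪hess (I₁.prod I₂) I φ x X Z, mfderiv (I₁.prod I₂) I φ x W⟫ =
      mvfderiv (I₁.prod I₂) (fun x : N₁ × N₂ ↦ Real.log (f x.1)) x X * ⟪Z, W⟫ := by
  have h := inner_hess hφ.contMDiff X Z W
  rw [mvfderiv_inner_snd hM hφ hX hZ hW] at h
  simp only [mvfderiv_inner_immersion hM hφ, hX, hZ, hW, mvfderiv_inner_extend_zero_left,
    inner_zero_left, map_zero] at h
  linarith

theorem inner_hess_snd_snd {X Z W : TangentSpace (I₁.prod I₂) x} (hX : dsnd I₁ I₂ x X = 0)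
    (hZ : dfst I₁ I₂ x Z = 0) (hW : dfst I₁ I₂ x W = 0) :
    ⟪hess (I₁.prod I₂) I φ x Z W, mfderiv (I₁.prod I₂) I φ x X⟫ =
      -(mvfderiv (I₁.prod I₂) (fun x : N₁ × N₂ ↦ Real.log (f x.1)) x X * ⟪Z, W⟫) := by
  have h := inner_hess hφ.contMDiff Z W X
  rw [mvfderiv_inner_snd hM hφ hX hZ hW] at h
  simp only [mvfderiv_inner_immersion hM hφ, hX, hZ, hW, mvfderiv_inner_extend_zero_right,
    inner_zero_right, map_zero] at h
  linarith

end Hess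

end Warped

section Slices

variable {E₁ : Type*} [NormedAddCommGroup E₁] [NormedSpace ℝ E₁]
  {H₁ : Type*} [TopologicalSpace H₁] {I₁ : ModelWithCorners ℝ E₁ H₁} [I₁.Boundaryless]
  {N₁ : Type*} [TopologicalSpace N₁] [ChartedSpace H₁ N₁] [IsManifold I₁ ∞ N₁]
  {E₂ : Type*} [NormedAddCommGroup E₂] [NormedSpace ℝ E₂]
  {H₂ : Type*} [TopologicalSpace H₂] {I₂ : ModelWithCorners ℝ E₂ H₂} [I₂.Boundaryless]
  {N₂ : Type*} [TopologicalSpace N₂] [ChartedSpace H₂ N₂] [IsManifold I₂ ∞ N₂]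
  {E : Type*} [NormedAddCommGroup E] [NormedSpace ℝ E] [FiniteDimensional ℝ E]
  {H : Type*} [TopologicalSpace H] {I : ModelWithCorners ℝ E H} [I.Boundaryless]
  {N : Type*} [TopologicalSpace N] [ChartedSpace H N] [IsManifold I ∞ N]
  {φ : N₁ × N₂ → N}

theorem contMDiff_slice_fst (hφ : ContMDiff (I₁.prod I₂) I ∞ φ) (q : N₂) :
    ContMDiff I₁ I ∞ (fun p : N₁ ↦ φ (p, q)) :=
  hφ.comp (contMDiff_id.prodMk contMDiff_const)

theorem contMDiff_slice_snd (hφ : ContMDiff (I₁.prod I₂) I ∞ φ) (p : N₁) :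
    ContMDiff I₂ I ∞ (fun q : N₂ ↦ φ (p, q)) :=
  hφ.comp (contMDiff_const.prodMk contMDiff_id)

theorem mdifferentiableAt_prodMk_left (p : N₁) (q : N₂) :
    MDifferentiableAt I₁ (I₁.prod I₂) (fun p ↦ (p, q)) p :=
  mdifferentiableAt_id.prodMk mdifferentiableAt_const

theorem mdifferentiableAt_prodMk_right (p : N₁) (q : N₂) :
    MDifferentiableAt I₂ (I₁.prod I₂) (fun q ↦ (p, q)) q :=
  mdifferentiableAt_const.prodMk mdifferentiableAt_id

theorem mfderiv_slice_fst (hφ : ContMDiff (I₁.prod I₂) I ∞ φ) (x : N₁ × N₂)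
    (X : TangentSpace I₁ x.1) :
    mfderiv I₁ I (fun p ↦ φ (p, x.2)) x.1 X = mfderiv (I₁.prod I₂) I φ x (dinl I₁ I₂ x X) :=
  mfderiv_comp_apply (f := fun p : N₁ ↦ (p, x.2)) x.1 (hφ.mdifferentiable (by simp) x)
    (mdifferentiableAt_prodMk_left x.1 x.2) X

theorem mfderiv_slice_snd (hφ : ContMDiff (I₁.prod I₂) I ∞ φ) (x : N₁ × N₂)
    (Z : TangentSpace I₂ x.2) :
    mfderiv I₂ I (fun q ↦ φ (x.1, q)) x.2 Z = mfderiv (I₁.prod I₂) I φ x (dinr I₁ I₂ x Z) :=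
  mfderiv_comp_apply (f := fun q : N₂ ↦ (x.1, q)) x.2 (hφ.mdifferentiable (by simp) x)
    (mdifferentiableAt_prodMk_right x.1 x.2) Z

variable [RiemannianBundle (fun y : N ↦ TangentSpace I y)]
  [IsContMDiffRiemannianBundle I ∞ E (fun y : N ↦ TangentSpace I y)]

theorem hess_slice_fst (hφ : ContMDiff (I₁.prod I₂) I ∞ φ) (x : N₁ × N₂)
    (X Y : TangentSpace I₁ x.1) :
    hess I₁ I (fun p ↦ φ (p, x.2)) x.1 X Y =
      hess (I₁.prod I₂) I φ x (dinl I₁ I₂ x X) (dinl I₁ I₂ x Y) := by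
  have hs := contMDiff_slice_fst hφ x.2
  have hi := mdifferentiableAt_prodMk_left (I₁ := I₁) (I₂ := I₂) x.1 x.2
  have hd := diffAlong_mfderiv_extend hφ (dinl I₁ I₂ x Y)
  rw [← covAlong_mfderiv_extend hs, ← covAlong_mfderiv_extend hφ,
    covAlong_eq (hs.mdifferentiable (by simp) _), covAlong_eq (hφ.mdifferentiable (by simp) _),
    FiberBundle.extend_apply_self, FiberBundle.extend_apply_self, mfderiv_slice_fst hφ,
    mfderiv_slice_fst hφ]
  congr 2
  have h := mvfderiv_comp_vec (φ := fun p : N₁ ↦ (p, x.2)) (x₀ := x.1) hd hi X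
  refine Eq.trans ?_ h
  unfold derivComps
  congr 1
  refine mvfderiv_congr ?_
  filter_upwards [hi.continuousAt.eventually
    (eventually_mem_chart_source (H := ModelProd H₁ H₂) x)] with p hp
  congr 1
  refine (mfderiv_slice_fst hφ (p, x.2) _).trans (congrArg _ ?_)
  refine ext_dfst_dsnd ?_ ?_
  · rw [dfst_dinl, dfst_extend hp, dfst_dinl]
  · rw [dsnd_dinl, dsnd_extend hp, dsnd_dinl, extend_zero (mem_chart_source_prod hp).2]

theorem hess_slice_snd (hφ : ContMDiff (I₁.prod I₂) I ∞ φ) (x : N₁ × N₂)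
    (Z W : TangentSpace I₂ x.2) :
    hess I₂ I (fun q ↦ φ (x.1, q)) x.2 Z W =
      hess (I₁.prod I₂) I φ x (dinr I₁ I₂ x Z) (dinr I₁ I₂ x W) := by
  have hs := contMDiff_slice_snd hφ x.1
  have hi := mdifferentiableAt_prodMk_right (I₁ := I₁) (I₂ := I₂) x.1 x.2
  have hd := diffAlong_mfderiv_extend hφ (dinr I₁ I₂ x W)
  rw [← covAlong_mfderiv_extend hs, ← covAlong_mfderiv_extend hφ,
    covAlong_eq (hs.mdifferentiable (by simp) _), covAlong_eq (hφ.mdifferentiable (by simp) _),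
    FiberBundle.extend_apply_self, FiberBundle.extend_apply_self, mfderiv_slice_snd hφ,
    mfderiv_slice_snd hφ]
  congr 2
  have h := mvfderiv_comp_vec (φ := fun q : N₂ ↦ (x.1, q)) (x₀ := x.2) hd hi Z
  refine Eq.trans ?_ h
  unfold derivComps
  congr 1
  refine mvfderiv_congr ?_
  filter_upwards [hi.continuousAt.eventually
    (eventually_mem_chart_source (H := ModelProd H₁ H₂) x)] with q hq
  congr 1
  refine (mfderiv_slice_snd hφ (x.1, q) _).trans (congrArg _ ?_)
  refine ext_dfst_dsnd ?_ ?_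
  · rw [dfst_dinr, dfst_extend hq, dfst_dinr, extend_zero (mem_chart_source_prod hq).1]
  · rw [dsnd_dinr, dsnd_extend hq, dsnd_dinr]

end Slices

section Extremum

variable {E : Type*} [NormedAddCommGroup E] [NormedSpace ℝ E]
  {H : Type*} [TopologicalSpace H] {I : ModelWithCorners ℝ E H} [I.Boundaryless]
  {N : Type*} [TopologicalSpace N] [ChartedSpace H N] [IsManifold I ∞ N]

theorem mvfderiv_eq_zero_of_isLocalMax {K : N → ℝ} {y : N} (hK : MDifferentiableAt I 𝓘(ℝ, ℝ) K y)
    (h : IsLocalMax K y) (u : TangentSpace I y) : mvfderiv I K y u = 0 := by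
  have hc : ContinuousAt (extChartAt I y).symm (extChartAt I y y) := continuousAt_extChartAt_symm y
  have hm : IsLocalMax (K ∘ (extChartAt I y).symm) (extChartAt I y y) := by
    have h' : ∀ᶠ z in 𝓝 ((extChartAt I y).symm (extChartAt I y y)), K z ≤ K y := by
      rwa [extChartAt_to_inv]
    filter_upwards [hc.eventually h'] with z hz
    simpa using hz
  rw [mvfderiv_eq_fderiv hK, hm.fderiv_eq_zero, zero_apply]

end Extremum

section SemiSlant

variable {E₁ : Type*} [NormedAddCommGroup E₁] [NormedSpace ℝ E₁] [FiniteDimensional ℝ E₁]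
  {H₁ : Type*} [TopologicalSpace H₁] {I₁ : ModelWithCorners ℝ E₁ H₁} [I₁.Boundaryless]
  {N₁ : Type*} [TopologicalSpace N₁] [ChartedSpace H₁ N₁] [IsManifold I₁ ∞ N₁]
  [RiemannianBundle (fun p : N₁ ↦ TangentSpace I₁ p)]
  [IsContMDiffRiemannianBundle I₁ ∞ E₁ (fun p : N₁ ↦ TangentSpace I₁ p)]
  {E₂ : Type*} [NormedAddCommGroup E₂] [NormedSpace ℝ E₂] [FiniteDimensional ℝ E₂]
  {H₂ : Type*} [TopologicalSpace H₂] {I₂ : ModelWithCorners ℝ E₂ H₂} [I₂.Boundaryless]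
  {N₂ : Type*} [TopologicalSpace N₂] [ChartedSpace H₂ N₂] [IsManifold I₂ ∞ N₂]
  [RiemannianBundle (fun q : N₂ ↦ TangentSpace I₂ q)]
  [IsContMDiffRiemannianBundle I₂ ∞ E₂ (fun q : N₂ ↦ TangentSpace I₂ q)]
  [RiemannianBundle (fun x : N₁ × N₂ ↦ TangentSpace (I₁.prod I₂) x)]
  {f : N₁ → ℝ}
  {E : Type*} [NormedAddCommGroup E] [NormedSpace ℝ E] [FiniteDimensional ℝ E]
  {H : Type*} [TopologicalSpace H] {I : ModelWithCorners ℝ E H} [I.Boundaryless]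
  {N : Type*} [TopologicalSpace N] [ChartedSpace H N] [IsManifold I ∞ N]
  [RiemannianBundle (fun y : N ↦ TangentSpace I y)]
  [IsContMDiffRiemannianBundle I ∞ E (fun y : N ↦ TangentSpace I y)]
  {J : ∀ y : N, TangentSpace I y →L[ℝ] TangentSpace I y} {φ : N₁ × N₂ → N} {c : ℝ}

variable (I₁ I₂ I) in
/-- The first factor is holomorphic, and on the second factor the tangential part `P` of `J` is
`c` times an isometry. -/
structure IsSemiSlant (J : ∀ y : N, TangentSpace I y →L[ℝ] TangentSpace I y) (φ : N₁ × N₂ → N)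
    (c : ℝ) : Prop where
  exists_fst : ∀ (x : N₁ × N₂) (X : TangentSpace (I₁.prod I₂) x), dsnd I₁ I₂ x X = 0 →
    ∃ X' : TangentSpace (I₁.prod I₂) x, dsnd I₁ I₂ x X' = 0 ∧
      mfderiv (I₁.prod I₂) I φ x X' = J (φ x) (mfderiv (I₁.prod I₂) I φ x X)
  exists_snd : ∀ (x : N₁ × N₂) (Z : TangentSpace (I₁.prod I₂) x), dfst I₁ I₂ x Z = 0 →
    ∃ W : TangentSpace (I₁.prod I₂) x, dfst I₁ I₂ x W = 0 ∧
      (∀ V : TangentSpace (I₁.prod I₂) x, dfst I₁ I₂ x V = 0 →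
        ⟪J (φ x) (mfderiv (I₁.prod I₂) I φ x Z), mfderiv (I₁.prod I₂) I φ x V⟫ = ⟪W, V⟫) ∧
      ⟪W, W⟫ = c ^ 2 * ⟪Z, Z⟫

theorem IsWarpedProduct.inner_fst_snd (hM : IsWarpedProduct I₁ I₂ (N₁ := N₁) (N₂ := N₂) f)
    {x : N₁ × N₂} {X Z : TangentSpace (I₁.prod I₂) x} (hX : dsnd I₁ I₂ x X = 0)
    (hZ : dfst I₁ I₂ x Z = 0) : ⟪X, Z⟫ = 0 := by
  rw [hM.inner_eq_dfst_dsnd, hX, hZ, inner_zero_left, inner_zero_right, mul_zero, add_zero]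

section

variable (hM : IsWarpedProduct I₁ I₂ (N₁ := N₁) (N₂ := N₂) f)
  (hφ : IsIsometricImmersion (I₁.prod I₂) I φ) (hS : IsSemiSlant I₁ I₂ I J φ c)

include hM hφ hS

theorem inner_map_snd_fst (hJ : IsAlmostHermitian J) {x : N₁ × N₂}
    {X Z : TangentSpace (I₁.prod I₂) x} (hX : dsnd I₁ I₂ x X = 0) (hZ : dfst I₁ I₂ x Z = 0) :
    ⟪J (φ x) (mfderiv (I₁.prod I₂) I φ x Z), mfderiv (I₁.prod I₂) I φ x X⟫ = 0 := by
  obtain ⟨X', hX', e⟩ := hS.exists_fst x X hX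
  rw [hJ.inner_map_left, ← e, hφ.inner_mfderiv, real_inner_comm, hM.inner_fst_snd hX' hZ, neg_zero]

theorem inner_hess_map_snd (hJ : IsNearlyKaehler J) {x : N₁ × N₂}
    {X X' Z W : TangentSpace (I₁.prod I₂) x} (hX : dsnd I₁ I₂ x X = 0)
    (hX' : dsnd I₁ I₂ x X' = 0)
    (e : mfderiv (I₁.prod I₂) I φ x X' = J (φ x) (mfderiv (I₁.prod I₂) I φ x X))
    (hZ : dfst I₁ I₂ x Z = 0) (hW : dfst I₁ I₂ x W = 0) :
    ⟪hess (I₁.prod I₂) I φ x X W, J (φ x) (mfderiv (I₁.prod I₂) I φ x Z)⟫ =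
      -(mvfderiv (I₁.prod I₂) (fun x : N₁ × N₂ ↦ Real.log (f x.1)) x X' * ⟪W, Z⟫)
      - ⟪nablaEnd J (φ x) (mfderiv (I₁.prod I₂) I φ x X) (mfderiv (I₁.prod I₂) I φ x W),
          mfderiv (I₁.prod I₂) I φ x Z⟫ := by
  have hH := hJ.toIsAlmostHermitian
  have h := mvfderiv_inner_map_mfderiv hH hφ.contMDiff W Z X
  have h0 : (fun z ↦ ⟪J (φ z) (mfderiv (I₁.prod I₂) I φ z (FiberBundle.extend (E₁ × E₂) Z z)),
        mfderiv (I₁.prod I₂) I φ z (FiberBundle.extend (E₁ × E₂) X z)⟫) =ᶠ[𝓝 x]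
        fun _ ↦ (0 : ℝ) := by
    filter_upwards [eventually_mem_chart_source (H := ModelProd H₁ H₂) x] with z hz
    refine inner_map_snd_fst hM hφ hS hH ?_ ?_
    · rw [dsnd_extend hz, hX, extend_zero (mem_chart_source_prod hz).2]
    · rw [dfst_extend hz, hZ, extend_zero (mem_chart_source_prod hz).1]
  rw [mvfderiv_congr h0, mvfderiv_const, zero_apply] at h
  have h1 := inner_hess_snd_snd hM hφ hX' hW hZ
  rw [e] at h1
  rw [hH.inner_map_left, h1, hess_comm hφ.contMDiff W X,
    real_inner_comm (hess (I₁.prod I₂) I φ x X W)] at h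
  have h2 : ⟪nablaEnd J (φ x) (mfderiv (I₁.prod I₂) I φ x W) (mfderiv (I₁.prod I₂) I φ x Z),
      mfderiv (I₁.prod I₂) I φ x X⟫ =
      ⟪nablaEnd J (φ x) (mfderiv (I₁.prod I₂) I φ x X) (mfderiv (I₁.prod I₂) I φ x W),
          mfderiv (I₁.prod I₂) I φ x Z⟫ := by
    rw [inner_nablaEnd hH, hJ.nablaEnd_swap, inner_neg_right, neg_neg, real_inner_comm]
  rw [h2] at h
  linarith

theorem mvfderiv_inner_map_snd (hJ : IsNearlyKaehler J) {x : N₁ × N₂}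
    {X Z W : TangentSpace (I₁.prod I₂) x} (hX : dsnd I₁ I₂ x X = 0)
    (hZ : dfst I₁ I₂ x Z = 0) (hW : dfst I₁ I₂ x W = 0) :
    mvfderiv (I₁.prod I₂) (fun z ↦
        ⟪J (φ z) (mfderiv (I₁.prod I₂) I φ z (FiberBundle.extend (E₁ × E₂) Z z)),
        mfderiv (I₁.prod I₂) I φ z (FiberBundle.extend (E₁ × E₂) W z)⟫) x X =
      3 * ⟪nablaEnd J (φ x) (mfderiv (I₁.prod I₂) I φ x X) (mfderiv (I₁.prod I₂) I φ x Z),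
          mfderiv (I₁.prod I₂) I φ x W⟫ := by
  have hH := hJ.toIsAlmostHermitian
  obtain ⟨X', hX', e⟩ := hS.exists_fst x X hX
  have h1 := inner_hess_map_snd hM hφ hS hJ hX hX' e hZ hW
  have h2 := inner_hess_map_snd hM hφ hS hJ hX hX' e hW hZ
  have h3 := inner_nablaEnd hH (mfderiv (I₁.prod I₂) I φ x X) (mfderiv (I₁.prod I₂) I φ x W)
    (mfderiv (I₁.prod I₂) I φ x Z)
  rw [mvfderiv_inner_map_mfderiv hH hφ.contMDiff X Z W, hH.inner_map_left, h2,
    ← real_inner_comm (J (φ x) _) (hess _ _ _ _ _ _), h1, h3,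
    real_inner_comm _ (nablaEnd _ _ _ _), real_inner_comm W Z]
  ring

theorem mvfderiv_inner_map_slant (hJ : IsNearlyKaehler J) {x : N₁ × N₂}
    {X Z W : TangentSpace (I₁.prod I₂) x} (hX : dsnd I₁ I₂ x X = 0)
    (hZ : dfst I₁ I₂ x Z = 0) (hW : dfst I₁ I₂ x W = 0)
    (hZW : ⟪J (φ x) (mfderiv (I₁.prod I₂) I φ x Z), mfderiv (I₁.prod I₂) I φ x W⟫ = ⟪W, W⟫)
    (hWW : ⟪W, W⟫ = c ^ 2 * ⟪Z, Z⟫) :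
    mvfderiv (I₁.prod I₂) (fun z ↦
        ⟪J (φ z) (mfderiv (I₁.prod I₂) I φ z (FiberBundle.extend (E₁ × E₂) Z z)),
        mfderiv (I₁.prod I₂) I φ z (FiberBundle.extend (E₁ × E₂) W z)⟫) x X =
      2 * c ^ 2 * mvfderiv (I₁.prod I₂) (fun x : N₁ × N₂ ↦ Real.log (f x.1)) x X * ⟪Z, Z⟫ := by
  have hH := hJ.toIsAlmostHermitian
  set F : N₁ × N₂ → ℝ := fun z ↦
        ⟪J (φ z) (mfderiv (I₁.prod I₂) I φ z (FiberBundle.extend (E₁ × E₂) Z z)),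
        mfderiv (I₁.prod I₂) I φ z (FiberBundle.extend (E₁ × E₂) W z)⟫ with hFdef
  set A : TangentSpace (I₁.prod I₂) x → N₁ × N₂ → ℝ := fun V z ↦
        ⟪mfderiv (I₁.prod I₂) I φ z (FiberBundle.extend (E₁ × E₂) V z),
        mfderiv (I₁.prod I₂) I φ z (FiberBundle.extend (E₁ × E₂) V z)⟫ with hAdef
  have hd := hφ.contMDiff.mdifferentiable (by simp) x
  have hF : MDifferentiableAt (I₁.prod I₂) 𝓘(ℝ, ℝ) F x :=
    mdifferentiableAt_inner_map_mfderiv hH hφ.contMDiff Z W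
  have hA : ∀ V, MDifferentiableAt (I₁.prod I₂) 𝓘(ℝ, ℝ) (A V) x := fun V ↦
    mdifferentiableAt_inner_of_diffAlong hd (diffAlong_mfderiv_extend hφ.contMDiff V)
      (diffAlong_mfderiv_extend hφ.contMDiff V)
  have hC : MDifferentiableAt (I₁.prod I₂) 𝓘(ℝ, ℝ) (fun _ : N₁ × N₂ ↦ c ^ 2) x :=
    mdifferentiableAt_const
  have hC2 : MDifferentiableAt (I₁.prod I₂) 𝓘(ℝ, ℝ) (fun _ : N₁ × N₂ ↦ (2 : ℝ)) x :=
    mdifferentiableAt_const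
  have hK := ((hC2.mul hF).sub (hC.mul (hA Z))).sub (hA W)
  have hmax : IsLocalMax ((fun _ : N₁ × N₂ ↦ (2 : ℝ)) * F - (fun _ : N₁ × N₂ ↦ c ^ 2) * A Z - A W)
      x := by
    have hx0 : ((fun _ : N₁ × N₂ ↦ (2 : ℝ)) * F - (fun _ : N₁ × N₂ ↦ c ^ 2) * A Z - A W) x = 0 := by
      simp only [Pi.sub_apply, Pi.mul_apply, hFdef, hAdef, FiberBundle.extend_apply_self, hZW,
        hφ.inner_mfderiv, hWW]
      ring
    unfold IsLocalMax IsMaxFilter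
    rw [hx0]
    filter_upwards [eventually_mem_chart_source (H := ModelProd H₁ H₂) x] with z hz
    have hZ0 : dfst I₁ I₂ z (FiberBundle.extend (E₁ × E₂) Z z) = 0 := by
      rw [dfst_extend hz, hZ, extend_zero (mem_chart_source_prod hz).1]
    have hW0 : dfst I₁ I₂ z (FiberBundle.extend (E₁ × E₂) W z) = 0 := by
      rw [dfst_extend hz, hW, extend_zero (mem_chart_source_prod hz).1]
    obtain ⟨V, -, hV, hVV⟩ := hS.exists_snd z _ hZ0
    simp only [Pi.sub_apply, Pi.mul_apply, hFdef, hAdef, hφ.inner_mfderiv, hV _ hW0, ← hVV]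
    have h0 : 0 ≤ ⟪V - FiberBundle.extend (E₁ × E₂) W z, V - FiberBundle.extend (E₁ × E₂) W z⟫ :=
      real_inner_self_nonneg
    rw [inner_sub_left, inner_sub_right, inner_sub_right,
      real_inner_comm V (FiberBundle.extend (E₁ × E₂) W z)] at h0
    linarith
  have h := mvfderiv_eq_zero_of_isLocalMax hK hmax X
  rw [mvfderiv_sub ((hC2.mul hF).sub (hC.mul (hA Z))) (hA W), sub_apply,
    mvfderiv_sub (hC2.mul hF) (hC.mul (hA Z)), sub_apply, mvfderiv_mul hC2 hF,
    mvfderiv_mul hC (hA Z)] at h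
  simp only [add_apply, smul_apply, smul_eq_mul, mvfderiv_const, zero_apply, mul_zero,
    add_zero] at h
  have hZ1 := mvfderiv_inner_snd hM hφ hX hZ hZ
  have hW1 := mvfderiv_inner_snd hM hφ hX hW hW
  rw [hAdef, hZ1, hW1, hWW] at h
  linarith

theorem three_mul_inner_hess_map_slant (hJ : IsNearlyKaehler J) {x : N₁ × N₂}
    {X Z W : TangentSpace (I₁.prod I₂) x} (hX : dsnd I₁ I₂ x X = 0)
    (hZ : dfst I₁ I₂ x Z = 0) (hW : dfst I₁ I₂ x W = 0)
    (hV : ∀ V : TangentSpace (I₁.prod I₂) x, dfst I₁ I₂ x V = 0 →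
        ⟪J (φ x) (mfderiv (I₁.prod I₂) I φ x Z), mfderiv (I₁.prod I₂) I φ x V⟫ = ⟪W, V⟫)
    (hWW : ⟪W, W⟫ = c ^ 2 * ⟪Z, Z⟫) :
    3 * ⟪hess (I₁.prod I₂) I φ x X Z, J (φ x) (mfderiv (I₁.prod I₂) I φ x W)⟫ =
      -(2 * c ^ 2 * mvfderiv (I₁.prod I₂) (fun x : N₁ × N₂ ↦ Real.log (f x.1)) x X * ⟪Z, Z⟫) := by
  have hH := hJ.toIsAlmostHermitian
  obtain ⟨X', hX', e⟩ := hS.exists_fst x X hX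
  have h0 := hH.inner_map_left (mfderiv (I₁.prod I₂) I φ x Z) (mfderiv (I₁.prod I₂) I φ x Z)
  rw [real_inner_comm (J (φ x) _), hV Z hZ, real_inner_comm] at h0
  rw [inner_hess_map_snd hM hφ hS hJ hX hX' e hW hZ, show ⟪Z, W⟫ = (0 : ℝ) by linarith,
    ← mvfderiv_inner_map_slant hM hφ hS hJ hX hZ hW (hV W hW) hWW,
    mvfderiv_inner_map_snd hM hφ hS hJ hX hZ hW]
  ring

theorem inner_hess_map_self (hJ : IsNearlyKaehler J) {x : N₁ × N₂}
    {X X' Z : TangentSpace (I₁.prod I₂) x} (hX : dsnd I₁ I₂ x X = 0)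
    (hX' : dsnd I₁ I₂ x X' = 0)
    (e : mfderiv (I₁.prod I₂) I φ x X' = J (φ x) (mfderiv (I₁.prod I₂) I φ x X))
    (hZ : dfst I₁ I₂ x Z = 0) :
    ⟪hess (I₁.prod I₂) I φ x X Z, J (φ x) (mfderiv (I₁.prod I₂) I φ x Z)⟫ =
      -(mvfderiv (I₁.prod I₂) (fun x : N₁ × N₂ ↦ Real.log (f x.1)) x X' * ⟪Z, Z⟫) := by
  have h := inner_nablaEnd hJ.toIsAlmostHermitian (mfderiv (I₁.prod I₂) I φ x X)
    (mfderiv (I₁.prod I₂) I φ x Z) (mfderiv (I₁.prod I₂) I φ x Z)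
  rw [real_inner_comm (nablaEnd _ _ _ _)] at h
  rw [inner_hess_map_snd hM hφ hS hJ hX hX' e hZ hZ]
  linarith

end

end SemiSlant

section Projection

variable {W : Type*} [NormedAddCommGroup W] [InnerProductSpace ℝ W]

theorem inner_starProjection_left (T : Submodule ℝ W) [T.HasOrthogonalProjection] (w : W)
    {v : W} (hv : v ∈ T) : ⟪T.starProjection w, v⟫ = ⟪w, v⟫ := by
  rw [Submodule.inner_starProjection_left_eq_right, Submodule.starProjection_eq_self_iff.2 hv]

/-- If the angle between `w` and a subspace is `θ`, the projection of `w` has norm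
`|cos θ| ‖w‖`. -/
theorem inner_starProjection_self_of_angle (T : Submodule ℝ W) [T.HasOrthogonalProjection] (w : W) :
    ⟪T.starProjection w, T.starProjection w⟫ =
      Real.cos (InnerProductGeometry.angle w (T.starProjection w)) ^ 2 * ⟪w, w⟫ := by
  have h1 := inner_starProjection_left T w (T.starProjection_apply_mem w)
  have h2 := InnerProductGeometry.cos_angle_mul_norm_mul_norm w (T.starProjection w)
  rcases eq_or_ne (T.starProjection w) 0 with h | h
  · rw [h, InnerProductGeometry.angle_zero_right, Real.cos_pi_div_two, inner_zero_left]
    ring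
  · rw [← h1, real_inner_self_eq_norm_sq, sq, ← mul_assoc] at h2
    have h3 := mul_right_cancel₀ (norm_ne_zero_iff.2 h) h2
    rw [real_inner_self_eq_norm_sq, real_inner_self_eq_norm_sq, ← h3]
    ring

end Projection

section Submanifold

variable {E' : Type*} [NormedAddCommGroup E'] [NormedSpace ℝ E']
  {H' : Type*} [TopologicalSpace H'] {I' : ModelWithCorners ℝ E' H'}
  {M : Type*} [TopologicalSpace M] [ChartedSpace H' M] [IsManifold I' ∞ M]
  {E : Type*} [NormedAddCommGroup E] [NormedSpace ℝ E] [FiniteDimensional ℝ E]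
  {H : Type*} [TopologicalSpace H] {I : ModelWithCorners ℝ E H}
  {N : Type*} [TopologicalSpace N] [ChartedSpace H N] [IsManifold I ∞ N]
  [RiemannianBundle (fun y : N ↦ TangentSpace I y)]
  {ψ : M → N} {x : M}

theorem mfderiv_mem_tangentImage (u : TangentSpace I' x) :
    mfderiv I' I ψ x u ∈ tangentImage I' I ψ x :=
  ⟨u, rfl⟩

theorem exists_eq_of_mem_tangentImage {w : TangentSpace I (ψ x)} (h : w ∈ tangentImage I' I ψ x) :
    ∃ u : TangentSpace I' x, mfderiv I' I ψ x u = w :=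
  h

variable (I' I ψ x) in
/-- The projection to the normal space, as a linear map. -/
def normalMap : TangentSpace I (ψ x) →ₗ[ℝ] TangentSpace I (ψ x) :=
  LinearMap.id - (tangentImage I' I ψ x).starProjection.toLinearMap

theorem inner_tangentPart_mfderiv (w : TangentSpace I (ψ x)) (u : TangentSpace I' x) :
    ⟪tangentPart I' I ψ x w, mfderiv I' I ψ x u⟫ = ⟪w, mfderiv I' I ψ x u⟫ :=
  inner_starProjection_left _ _ (mfderiv_mem_tangentImage u)

theorem exists_mfderiv_eq_tangentPart (w : TangentSpace I (ψ x)) :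
    ∃ u : TangentSpace I' x, mfderiv I' I ψ x u = tangentPart I' I ψ x w :=
  exists_eq_of_mem_tangentImage (Submodule.starProjection_apply_mem _ w)

theorem inner_normalPart_mfderiv (w : TangentSpace I (ψ x)) (u : TangentSpace I' x) :
    ⟪normalPart I' I ψ x w, mfderiv I' I ψ x u⟫ = 0 := by
  rw [normalPart, inner_sub_left, inner_tangentPart_mfderiv, sub_self]

theorem normalPart_eq_sub {w : TangentSpace I (ψ x)} {t : TangentSpace I' x}
    (h : ∀ u : TangentSpace I' x, ⟪w - mfderiv I' I ψ x t, mfderiv I' I ψ x u⟫ = 0) :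
    normalPart I' I ψ x w = w - mfderiv I' I ψ x t := by
  rw [normalPart, tangentPart, Submodule.eq_starProjection_of_mem_of_inner_eq_zero
    (mfderiv_mem_tangentImage t)]
  intro v hv
  obtain ⟨u, rfl⟩ := exists_eq_of_mem_tangentImage hv
  exact h u

theorem mfderiv_inducedFrame (i : Fin (Module.finrank ℝ (tangentImage I' I ψ x))) :
    mfderiv I' I ψ x (inducedFrame I' I ψ x i) =
      (stdOrthonormalBasis ℝ (tangentImage I' I ψ x) i : TangentSpace I (ψ x)) :=
  Classical.choose_spec (LinearMap.mem_range.1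
    (stdOrthonormalBasis ℝ (tangentImage I' I ψ x) i).2)

theorem eq_inner_smul_meanCurvature {ν : TangentSpace I (ψ x)}
    (h : ∀ u v : TangentSpace I' x, secondFundamentalForm I' I ψ x u v =
      ⟪mfderiv I' I ψ x u, mfderiv I' I ψ x v⟫ • ν) (u v : TangentSpace I' x) :
    secondFundamentalForm I' I ψ x u v =
      ⟪mfderiv I' I ψ x u, mfderiv I' I ψ x v⟫ • meanCurvature I' I ψ x := by
  rcases Nat.eq_zero_or_pos (Module.finrank ℝ (tangentImage I' I ψ x)) with h0 | h0
  · have h1 : mfderiv I' I ψ x u = 0 := by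
      have := mfderiv_mem_tangentImage (I := I) (ψ := ψ) u
      rwa [Submodule.finrank_eq_zero.1 h0, Submodule.mem_bot] at this
    rw [h, h1, inner_zero_left, zero_smul, zero_smul]
  · have h2 : ∀ i, ⟪mfderiv I' I ψ x (inducedFrame I' I ψ x i),
        mfderiv I' I ψ x (inducedFrame I' I ψ x i)⟫ = (1 : ℝ) := by
      intro i
      rw [mfderiv_inducedFrame, ← Submodule.coe_inner, real_inner_self_eq_norm_sq,
        OrthonormalBasis.norm_eq_one, one_pow]
    have h3 : meanCurvature I' I ψ x = ν := by
      unfold meanCurvature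
      simp only [h, h2, one_smul]
      rw [Finset.sum_const, Finset.card_univ, Fintype.card_fin, ← Nat.cast_smul_eq_nsmul ℝ,
        smul_smul, one_div, inv_mul_cancel₀ (by positivity), one_smul]
    rw [h, h3]

variable [FiniteDimensional ℝ E'] [RiemannianBundle (fun x : M ↦ TangentSpace I' x)]

theorem exists_orthonormalBasis_inducedFrame (hψ : IsIsometricImmersion I' I ψ) (x : M) :
    ∃ e : OrthonormalBasis (Fin (Module.finrank ℝ (tangentImage I' I ψ x))) ℝ (TangentSpace I' x),
      ∀ i, inducedFrame I' I ψ x i = e i := by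
  let L : TangentSpace I' x →ₗᵢ[ℝ] TangentSpace I (ψ x) :=
    (mfderiv I' I ψ x).toLinearMap.isometryOfInner (hψ.inner_mfderiv x)
  let e : TangentSpace I' x ≃ₗᵢ[ℝ] tangentImage I' I ψ x := L.equivRange
  have he : ∀ t : tangentImage I' I ψ x, mfderiv I' I ψ x (e.symm t) = t := fun t ↦
    congrArg Subtype.val (e.apply_symm_apply t)
  refine ⟨(stdOrthonormalBasis ℝ (tangentImage I' I ψ x)).map e.symm, fun i ↦ L.injective ?_⟩
  rw [OrthonormalBasis.map_apply]
  exact (mfderiv_inducedFrame i).trans (he _).symm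

section Slant

variable {J : ∀ y : N, TangentSpace I y →L[ℝ] TangentSpace I y} {θ : ℝ}

theorem IsSlant.inner_tangentPart_self
    [IsContMDiffRiemannianBundle I ∞ E (fun y : N ↦ TangentSpace I y)] (hJ : IsAlmostHermitian J)
    (hs : IsSlant I' I J ψ θ) (x : M) (u : TangentSpace I' x) :
    ⟪tangentPart I' I ψ x (J (ψ x) (mfderiv I' I ψ x u)),
      tangentPart I' I ψ x (J (ψ x) (mfderiv I' I ψ x u))⟫ =
      Real.cos θ ^ 2 * ⟪mfderiv I' I ψ x u, mfderiv I' I ψ x u⟫ := by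
  rcases eq_or_ne u 0 with rfl | hu
  · simp [tangentPart]
  · have h := inner_starProjection_self_of_angle (tangentImage I' I ψ x)
      (J (ψ x) (mfderiv I' I ψ x u))
    have h' : InnerProductGeometry.angle (J (ψ x) (mfderiv I' I ψ x u))
      ((tangentImage I' I ψ x).starProjection (J (ψ x) (mfderiv I' I ψ x u))) = θ := hs x u hu
    rw [h', hJ.inner_map_map] at h
    exact h

theorem IsProperSlant.sin_ne_zero
    [IsContMDiffRiemannianBundle I ∞ E (fun y : N ↦ TangentSpace I y)] (hJ : IsAlmostHermitian J)
    (hs : IsProperSlant I' I J ψ θ) : Real.sin θ ≠ 0 := by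
  intro h0
  have hc : Real.cos θ ^ 2 = 1 := by
    have := Real.sin_sq_add_cos_sq θ
    rw [h0] at this
    linarith
  have hm : ∀ (x : M), ∀ w ∈ tangentImage I' I ψ x, J (ψ x) w ∈ tangentImage I' I ψ x := by
    intro x w hw
    obtain ⟨u, rfl⟩ := exists_eq_of_mem_tangentImage hw
    obtain ⟨v, hv⟩ := exists_mfderiv_eq_tangentPart (I' := I') (J (ψ x) (mfderiv I' I ψ x u))
    have h1 := hs.1.inner_tangentPart_self hJ x u
    have h2 := inner_tangentPart_mfderiv (J (ψ x) (mfderiv I' I ψ x u)) v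
    rw [hv] at h2
    have h3 : J (ψ x) (mfderiv I' I ψ x u) - tangentPart I' I ψ x (J (ψ x) (mfderiv I' I ψ x u))
        = 0 := by
      rw [← inner_self_eq_zero (𝕜 := ℝ), inner_sub_left, inner_sub_right, inner_sub_right, ← h2,
        real_inner_comm (J (ψ x) (mfderiv I' I ψ x u)) (tangentPart I' I ψ x _), ← h2, h1, hJ.inner_map_map, hc]
      ring
    rw [sub_eq_zero.1 h3, ← hv]
    exact mfderiv_mem_tangentImage v
  refine hs.2.1 fun x ↦ le_antisymm ?_ ?_
  · rintro _ ⟨w, hw, rfl⟩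
    exact hm x w hw
  · intro w hw
    refine ⟨-(J (ψ x) w), Submodule.neg_mem _ (hm x w hw), ?_⟩
    change J (ψ x) (-(J (ψ x) w)) = w
    rw [map_neg, hJ.sq, neg_neg]

theorem IsProperSlant.cos_ne_zero
    [IsContMDiffRiemannianBundle I ∞ E (fun y : N ↦ TangentSpace I y)] (hJ : IsAlmostHermitian J)
    (hs : IsProperSlant I' I J ψ θ) : Real.cos θ ≠ 0 := by
  intro h0
  refine hs.2.2 fun x ↦ ?_
  rintro _ ⟨w, hw, rfl⟩
  obtain ⟨u, rfl⟩ := exists_eq_of_mem_tangentImage hw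
  have h1 := hs.1.inner_tangentPart_self hJ x u
  rw [h0, zero_pow two_ne_zero, zero_mul, inner_self_eq_zero] at h1
  rw [Submodule.mem_orthogonal']
  intro v hv
  obtain ⟨v, rfl⟩ := exists_eq_of_mem_tangentImage hv
  refine (inner_tangentPart_mfderiv _ v).symm.trans ?_
  exact (congrArg (fun t ↦ ⟪t, mfderiv I' I ψ x v⟫) h1).trans (inner_zero_left _)

end Slant

end Submanifold

section MainResult

variable {E₁ : Type*} [NormedAddCommGroup E₁] [NormedSpace ℝ E₁] [FiniteDimensional ℝ E₁]
  {H₁ : Type*} [TopologicalSpace H₁] {I₁ : ModelWithCorners ℝ E₁ H₁} [I₁.Boundaryless]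
  {N₁ : Type*} [TopologicalSpace N₁] [ChartedSpace H₁ N₁] [IsManifold I₁ ∞ N₁]
  [RiemannianBundle (fun p : N₁ ↦ TangentSpace I₁ p)]
  [IsContMDiffRiemannianBundle I₁ ∞ E₁ (fun p : N₁ ↦ TangentSpace I₁ p)]
  {E₂ : Type*} [NormedAddCommGroup E₂] [NormedSpace ℝ E₂] [FiniteDimensional ℝ E₂]
  {H₂ : Type*} [TopologicalSpace H₂] {I₂ : ModelWithCorners ℝ E₂ H₂} [I₂.Boundaryless]
  {N₂ : Type*} [TopologicalSpace N₂] [ChartedSpace H₂ N₂] [IsManifold I₂ ∞ N₂]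
  [RiemannianBundle (fun q : N₂ ↦ TangentSpace I₂ q)]
  [IsContMDiffRiemannianBundle I₂ ∞ E₂ (fun q : N₂ ↦ TangentSpace I₂ q)]
  [RiemannianBundle (fun x : N₁ × N₂ ↦ TangentSpace (I₁.prod I₂) x)]
  {f : N₁ → ℝ}
  {E : Type*} [NormedAddCommGroup E] [NormedSpace ℝ E] [FiniteDimensional ℝ E]
  {H : Type*} [TopologicalSpace H] {I : ModelWithCorners ℝ E H} [I.Boundaryless]
  {N : Type*} [TopologicalSpace N] [ChartedSpace H N] [IsManifold I ∞ N]
  [RiemannianBundle (fun y : N ↦ TangentSpace I y)]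
  [IsContMDiffRiemannianBundle I ∞ E (fun y : N ↦ TangentSpace I y)]
  {J : ∀ y : N, TangentSpace I y →L[ℝ] TangentSpace I y} {φ : N₁ × N₂ → N} {θ : ℝ}


theorem isSemiSlant_cos (hJ : IsAlmostHermitian J) (hφ : IsIsometricImmersion (I₁.prod I₂) I φ)
    (hT : ∀ q : N₂, IsHolomorphic I₁ I J (fun p : N₁ ↦ φ (p, q)))
    (hθ : ∀ p : N₁, IsSlant I₂ I J (fun q : N₂ ↦ φ (p, q)) θ) :
    IsSemiSlant I₁ I₂ I J φ (Real.cos θ) where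
  exists_fst x X hX := by
    have h1 := mfderiv_slice_fst hφ.contMDiff x (dfst I₁ I₂ x X)
    rw [dinl_dfst hX] at h1
    have h2 : J (φ x) (mfderiv I₁ I (fun p ↦ φ (p, x.2)) x.1 (dfst I₁ I₂ x X)) ∈
        tangentImage I₁ I (fun p ↦ φ (p, x.2)) x.1 := by
      rw [← hT x.2 x.1]
      exact ⟨_, mfderiv_mem_tangentImage _, rfl⟩
    obtain ⟨Y, hY⟩ := exists_eq_of_mem_tangentImage h2
    refine ⟨dinl I₁ I₂ x Y, dsnd_dinl x Y, ?_⟩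
    rw [← mfderiv_slice_fst hφ.contMDiff, hY, h1]
  exists_snd x Z hZ := by
    have h1 := mfderiv_slice_snd hφ.contMDiff x (dsnd I₁ I₂ x Z)
    rw [dinr_dsnd hZ] at h1
    obtain ⟨W, hW⟩ := exists_mfderiv_eq_tangentPart (I' := I₂) (ψ := fun q ↦ φ (x.1, q)) (x := x.2)
      (J (φ x) (mfderiv I₂ I (fun q ↦ φ (x.1, q)) x.2 (dsnd I₁ I₂ x Z)))
    have h2 := (hθ x.1).inner_tangentPart_self hJ x.2 (dsnd I₁ I₂ x Z)
    have h3 := inner_tangentPart_mfderiv (I' := I₂) (ψ := fun q ↦ φ (x.1, q)) (x := x.2)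
      (J (φ x) (mfderiv I₂ I (fun q ↦ φ (x.1, q)) x.2 (dsnd I₁ I₂ x Z)))
    have hW' := (mfderiv_slice_snd hφ.contMDiff x W).symm.trans hW
    refine ⟨dinr I₁ I₂ x W, dfst_dinr x W, fun V hV ↦ ?_, ?_⟩
    · have h4 := mfderiv_slice_snd hφ.contMDiff x (dsnd I₁ I₂ x V)
      rw [dinr_dsnd hV] at h4
      rw [← hφ.inner_mfderiv, ← h4, hW', ← h1]
      exact (h3 _).symm
    · rw [← hφ.inner_mfderiv, hW', ← hφ.inner_mfderiv x Z, ← h1]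
      exact h2

theorem mem_orthogonal_ker_dsnd (hM : IsWarpedProduct I₁ I₂ (N₁ := N₁) (N₂ := N₂) f)
    {x : N₁ × N₂} {Z : TangentSpace (I₁.prod I₂) x} :
    Z ∈ (LinearMap.ker (dsnd I₁ I₂ x).toLinearMap)ᗮ ↔ dfst I₁ I₂ x Z = 0 := by
  rw [Submodule.mem_orthogonal]
  refine ⟨fun h ↦ ?_, fun h X hX ↦ hM.inner_fst_snd hX h⟩
  have h1 := h (dinl I₁ I₂ x (dfst I₁ I₂ x Z)) (dsnd_dinl x _)
  rw [hM.inner_eq_dfst_dsnd, dfst_dinl, dsnd_dinl, inner_zero_left, mul_zero, add_zero] at h1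
  exact inner_self_eq_zero.1 h1

theorem finrank_orthogonal_ker_dsnd (x : N₁ × N₂) :
    Module.finrank ℝ (LinearMap.ker (dsnd I₁ I₂ x).toLinearMap)ᗮ = Module.finrank ℝ E₂ := by
  have h1 := (LinearMap.ker (dsnd I₁ I₂ x).toLinearMap).finrank_add_finrank_orthogonal
  have h2 := (dsnd I₁ I₂ x).toLinearMap.finrank_range_add_finrank_ker
  have h3 : LinearMap.range (dsnd I₁ I₂ x).toLinearMap = ⊤ :=
    LinearMap.range_eq_top.2 fun Z ↦ ⟨dinr I₁ I₂ x Z, dsnd_dinr x Z⟩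
  rw [h3, finrank_top] at h2
  have h4 : Module.finrank ℝ (TangentSpace I₂ x.2) = Module.finrank ℝ E₂ := rfl
  omega

variable (I₁ I₂) in
/-- The gradient on the product of the logarithm of the warping function. -/
abbrev gradLog (f : N₁ → ℝ) (x : N₁ × N₂) : TangentSpace (I₁.prod I₂) x :=
  grad (I₁.prod I₂) (fun x : N₁ × N₂ ↦ Real.log (f x.1)) x

theorem inner_gradLog (x : N₁ × N₂) (u : TangentSpace (I₁.prod I₂) x) :
    ⟪gradLog I₁ I₂ f x, u⟫ =
      mvfderiv (I₁.prod I₂) (fun x : N₁ × N₂ ↦ Real.log (f x.1)) x u :=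
  InnerProductSpace.toDual_symm_apply

theorem dsnd_gradLog (hM : IsWarpedProduct I₁ I₂ (N₁ := N₁) (N₂ := N₂) f) (x : N₁ × N₂) :
    dsnd I₁ I₂ x (gradLog I₁ I₂ f x) = 0 := by
  have h1 := inner_gradLog (f := f) x (dinr I₁ I₂ x (dsnd I₁ I₂ x (gradLog I₁ I₂ f x)))
  have h2 := mvfderiv_log_comp_fst hM (dinr I₁ I₂ x (dsnd I₁ I₂ x (gradLog I₁ I₂ f x)))
  rw [← h1, hM.inner_eq_dfst_dsnd, dfst_dinr, dsnd_dinr, inner_zero_right, zero_add,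
    map_zero] at h2
  have h3 := (hM.pos x.1).ne'
  simpa [h3] using h2

variable (I₁ I₂ I) in
/-- The second fundamental form as a bilinear map. -/
def sffMap (φ : N₁ × N₂ → N) (x : N₁ × N₂) : TangentSpace (I₁.prod I₂) x →ₗ[ℝ]
    TangentSpace (I₁.prod I₂) x →ₗ[ℝ] TangentSpace I (φ x) :=
  (hess (I₁.prod I₂) I φ x).compr₂ (normalMap (I₁.prod I₂) I φ x)

theorem sffMap_apply (hφ : ContMDiff (I₁.prod I₂) I ∞ φ) {x : N₁ × N₂}
    (u v : TangentSpace (I₁.prod I₂) x) :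
    sffMap I₁ I₂ I φ x u v = secondFundamentalForm (I₁.prod I₂) I φ x u v :=
  (secondFundamentalForm_eq hφ x u v).symm

theorem sffMap_mixed (hM : IsWarpedProduct I₁ I₂ (N₁ := N₁) (N₂ := N₂) f)
    (hφ : IsIsometricImmersion (I₁.prod I₂) I φ) {x : N₁ × N₂}
    {X Z : TangentSpace (I₁.prod I₂) x} (hX : dsnd I₁ I₂ x X = 0) (hZ : dfst I₁ I₂ x Z = 0) :
    sffMap I₁ I₂ I φ x X Z = hess (I₁.prod I₂) I φ x X Z -
      ⟪gradLog I₁ I₂ f x, X⟫ • mfderiv (I₁.prod I₂) I φ x Z := by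
  change normalPart (I₁.prod I₂) I φ x (hess (I₁.prod I₂) I φ x X Z) = _
  rw [← map_smul]
  refine normalPart_eq_sub fun u ↦ ?_
  rw [inner_sub_left, hφ.inner_mfderiv, real_inner_smul_left, inner_gradLog]
  nth_rw 1 [← dinl_add_dinr u]
  rw [map_add, inner_add_right, inner_hess_mixed_fst hM hφ hX (dsnd_dinl x _) hZ,
    inner_hess_mixed_snd hM hφ hX hZ (dfst_dinr x _), zero_add]
  nth_rw 2 [← dinl_add_dinr u]
  rw [inner_add_right, real_inner_comm (dinl _ _ _ _), hM.inner_fst_snd (dsnd_dinl x _) hZ,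
    zero_add, sub_self]

theorem exists_semiSlantData (hM : IsWarpedProduct I₁ I₂ (N₁ := N₁) (N₂ := N₂) f)
    (hJ : IsNearlyKaehler J) (hφ : IsIsometricImmersion (I₁.prod I₂) I φ)
    (hT : ∀ q : N₂, IsHolomorphic I₁ I J (fun p : N₁ ↦ φ (p, q)))
    (hθ : ∀ p : N₁, IsProperSlant I₂ I J (fun q : N₂ ↦ φ (p, q)) θ) (x : N₁ × N₂) :
    ∃ P, SemiSlantData (mfderiv (I₁.prod I₂) I φ x).toLinearMap (J (φ x)).toLinearMap
      (LinearMap.ker (dsnd I₁ I₂ x).toLinearMap) P (sffMap I₁ I₂ I φ x) (gradLog I₁ I₂ f x)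
      (Real.cos θ) (Real.sin θ) := by
  have hH := hJ.toIsAlmostHermitian
  have hS := isSemiSlant_cos hH hφ hT fun p ↦ (hθ p).1
  choose! P hP₁ hP₂ hP₃ using hS.exists_snd x
  have hJZ : ∀ Z : TangentSpace (I₁.prod I₂) x, dfst I₁ I₂ x Z = 0 →
      ⟪mfderiv (I₁.prod I₂) I φ x Z, J (φ x) (mfderiv (I₁.prod I₂) I φ x Z)⟫ = 0 := by
    intro Z _
    have h := hH.inner_map_left (mfderiv (I₁.prod I₂) I φ x Z) (mfderiv (I₁.prod I₂) I φ x Z)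
    rw [real_inner_comm] at h
    linarith
  refine ⟨P, ?_⟩
  constructor
  · exact hφ.inner_mfderiv x
  · exact hH.inner_map_map _
  · exact hH.sq _
  · exact fun X hX ↦ hS.exists_fst x X hX
  · intro Z hZ
    rw [mem_orthogonal_ker_dsnd hM] at hZ ⊢
    exact hP₁ Z hZ
  · intro Z hZ v
    rw [mem_orthogonal_ker_dsnd hM] at hZ
    change ⟪J (φ x) (mfderiv (I₁.prod I₂) I φ x Z), mfderiv (I₁.prod I₂) I φ x v⟫ = ⟪P Z, v⟫
    rw [← dinl_add_dinr v, map_add, inner_add_right, inner_add_right,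
      inner_map_snd_fst hM hφ hS hH (dsnd_dinl x _) hZ, real_inner_comm (dinl _ _ _ _),
      hM.inner_fst_snd (dsnd_dinl x _) (hP₁ Z hZ), hP₂ Z hZ _ (dfst_dinr x _)]
  · intro Z hZ
    rw [mem_orthogonal_ker_dsnd hM] at hZ
    exact hP₃ Z hZ
  · exact (hθ x.1).cos_ne_zero hH
  · exact (hθ x.1).sin_ne_zero hH
  · exact Real.sin_sq_add_cos_sq θ
  · exact dsnd_gradLog hM x
  · exact fun u v w ↦ inner_normalPart_mfderiv _ w
  · intro u v
    rw [sffMap_apply hφ.contMDiff, sffMap_apply hφ.contMDiff,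
      secondFundamentalForm_eq hφ.contMDiff, secondFundamentalForm_eq hφ.contMDiff,
      hess_comm hφ.contMDiff]
  · intro X hX Z hZ
    rw [mem_orthogonal_ker_dsnd hM] at hZ
    obtain ⟨X', hX', e⟩ := hS.exists_fst x X hX
    change ⟪sffMap I₁ I₂ I φ x X Z, J (φ x) (mfderiv (I₁.prod I₂) I φ x Z)⟫ =
      -⟪J (φ x) (mfderiv (I₁.prod I₂) I φ x X),
        mfderiv (I₁.prod I₂) I φ x (gradLog I₁ I₂ f x)⟫ * ⟪Z, Z⟫
    rw [sffMap_mixed hM hφ hX hZ, inner_sub_left, real_inner_smul_left, hJZ Z hZ, mul_zero, sub_zero,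
      inner_hess_map_self hM hφ hS hJ hX hX' e hZ, ← e, hφ.inner_mfderiv,
      real_inner_comm (gradLog I₁ I₂ f x), inner_gradLog, neg_mul]
  · intro X hX Z hZ
    rw [mem_orthogonal_ker_dsnd hM] at hZ
    change 3 * ⟪sffMap I₁ I₂ I φ x X Z, J (φ x) (mfderiv (I₁.prod I₂) I φ x (P Z))⟫ =
      Real.cos θ ^ 2 * ⟪gradLog I₁ I₂ f x, X⟫ * ⟪Z, Z⟫
    have h1 := three_mul_inner_hess_map_slant hM hφ hS hJ hX hZ (hP₁ Z hZ) (hP₂ Z hZ) (hP₃ Z hZ)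
    have h2 := hH.inner_map_left (mfderiv (I₁.prod I₂) I φ x Z) (mfderiv (I₁.prod I₂) I φ x (P Z))
    rw [hP₂ Z hZ _ (hP₁ Z hZ), hP₃ Z hZ] at h2
    rw [sffMap_mixed hM hφ hX hZ, inner_sub_left, real_inner_smul_left, inner_gradLog, mul_sub, h1]
    linear_combination (-3 * mvfderiv (I₁.prod I₂) (fun x : N₁ × N₂ ↦ Real.log (f x.1)) x X) * h2

theorem sqNorm_eq_sum_sffMap (hφ : IsIsometricImmersion (I₁.prod I₂) I φ) (x : N₁ × N₂) :
    ∃ e : OrthonormalBasis (Fin (Module.finrank ℝ (tangentImage (I₁.prod I₂) I φ x))) ℝ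
        (TangentSpace (I₁.prod I₂) x),
      sqNormSecondFundamentalForm (I₁.prod I₂) I φ x =
        ∑ i, ∑ j, ⟪sffMap I₁ I₂ I φ x (e i) (e j), sffMap I₁ I₂ I φ x (e i) (e j)⟫ ∧
      meanCurvature (I₁.prod I₂) I φ x =
        (1 / (Module.finrank ℝ (tangentImage (I₁.prod I₂) I φ x) : ℝ)) •
          ∑ i, sffMap I₁ I₂ I φ x (e i) (e i) := by
  obtain ⟨e, he⟩ := exists_orthonormalBasis_inducedFrame hφ x
  refine ⟨e, ?_, ?_⟩
  · unfold sqNormSecondFundamentalForm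
    simp only [he, sffMap_apply hφ.contMDiff]
  · unfold meanCurvature
    simp only [he, sffMap_apply hφ.contMDiff]

theorem secondFundamentalForm_slice_fst (hM : IsWarpedProduct I₁ I₂ (N₁ := N₁) (N₂ := N₂) f)
    (hφ : IsIsometricImmersion (I₁.prod I₂) I φ) (x : N₁ × N₂)
    (h : ∀ X Y : TangentSpace (I₁.prod I₂) x, dsnd I₁ I₂ x X = 0 → dsnd I₁ I₂ x Y = 0 →
      sffMap I₁ I₂ I φ x X Y = 0) (X Y : TangentSpace I₁ x.1) :
    secondFundamentalForm I₁ I (fun p ↦ φ (p, x.2)) x.1 X Y = 0 := by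
  obtain ⟨t, ht⟩ := exists_mfderiv_eq_tangentPart (I' := I₁.prod I₂) (ψ := φ) (x := x)
    (hess (I₁.prod I₂) I φ x (dinl I₁ I₂ x X) (dinl I₁ I₂ x Y))
  have h1 : hess (I₁.prod I₂) I φ x (dinl I₁ I₂ x X) (dinl I₁ I₂ x Y) =
      mfderiv (I₁.prod I₂) I φ x t := by
    rw [ht]
    exact sub_eq_zero.1 (h _ _ (dsnd_dinl x X) (dsnd_dinl x Y))
  have h2 := inner_hess_fst_fst hM hφ (dsnd_dinl x X) (dsnd_dinl x Y)
    (dfst_dinr x (dsnd I₁ I₂ x t))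
  rw [h1, hφ.inner_mfderiv, hM.inner_eq_dfst_dsnd, dfst_dinr, dsnd_dinr, inner_zero_right,
    zero_add] at h2
  have h3 : dsnd I₁ I₂ x t = 0 := by
    have h3 := (hM.pos x.1).ne'
    simpa [h3] using h2
  have h4 : hess I₁ I (fun p ↦ φ (p, x.2)) x.1 X Y -
      mfderiv I₁ I (fun p ↦ φ (p, x.2)) x.1 (dfst I₁ I₂ x t) = 0 := by
    rw [hess_slice_fst hφ.contMDiff, mfderiv_slice_fst hφ.contMDiff, dinl_dfst h3, h1]
    exact sub_self _
  rw [secondFundamentalForm_eq (contMDiff_slice_fst hφ.contMDiff x.2), normalPart_eq_sub, h4]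
  intro u
  rw [h4, inner_zero_left]

theorem secondFundamentalForm_slice_snd (hM : IsWarpedProduct I₁ I₂ (N₁ := N₁) (N₂ := N₂) f)
    (hφ : IsIsometricImmersion (I₁.prod I₂) I φ) (x : N₁ × N₂)
    (h : ∀ Z W : TangentSpace (I₁.prod I₂) x, dfst I₁ I₂ x Z = 0 → dfst I₁ I₂ x W = 0 →
      sffMap I₁ I₂ I φ x Z W = 0) (Z W : TangentSpace I₂ x.2) :
    secondFundamentalForm I₂ I (fun q ↦ φ (x.1, q)) x.2 Z W =
      ⟪mfderiv I₂ I (fun q ↦ φ (x.1, q)) x.2 Z, mfderiv I₂ I (fun q ↦ φ (x.1, q)) x.2 W⟫ •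
        (-mfderiv (I₁.prod I₂) I φ x (gradLog I₁ I₂ f x) : TangentSpace I (φ x)) := by
  obtain ⟨t, ht⟩ := exists_mfderiv_eq_tangentPart (I' := I₁.prod I₂) (ψ := φ) (x := x)
    (hess (I₁.prod I₂) I φ x (dinr I₁ I₂ x Z) (dinr I₁ I₂ x W))
  have h1 : hess (I₁.prod I₂) I φ x (dinr I₁ I₂ x Z) (dinr I₁ I₂ x W) =
      mfderiv (I₁.prod I₂) I φ x t := by
    rw [ht]
    exact sub_eq_zero.1 (h _ _ (dfst_dinr x Z) (dfst_dinr x W))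
  have hd : dsnd I₁ I₂ x (dinl I₁ I₂ x (dfst I₁ I₂ x t) +
      ⟪dinr I₁ I₂ x Z, dinr I₁ I₂ x W⟫ • gradLog I₁ I₂ f x) = 0 := by
    rw [map_add, map_smul, dsnd_dinl, dsnd_gradLog hM, smul_zero, add_zero]
  have h2 := inner_hess_snd_snd hM hφ hd (dfst_dinr x Z) (dfst_dinr x W)
  have h3 : dinl I₁ I₂ x (dfst I₁ I₂ x t) +
      ⟪dinr I₁ I₂ x Z, dinr I₁ I₂ x W⟫ • gradLog I₁ I₂ f x = 0 := by
    rw [← inner_self_eq_zero (𝕜 := ℝ)]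
    nth_rw 1 [inner_add_left]
    rw [h1, hφ.inner_mfderiv, ← inner_gradLog] at h2
    nth_rw 1 [← dinl_add_dinr t] at h2
    rw [inner_add_left, real_inner_comm _ (dinr I₁ I₂ x (dsnd I₁ I₂ x t)),
      hM.inner_fst_snd hd (dfst_dinr x _), add_zero] at h2
    rw [h2, real_inner_smul_left]
    ring
  have h4 : hess I₂ I (fun q ↦ φ (x.1, q)) x.2 Z W -
      mfderiv I₂ I (fun q ↦ φ (x.1, q)) x.2 (dsnd I₁ I₂ x t) =
      mfderiv (I₁.prod I₂) I φ x (dinl I₁ I₂ x (dfst I₁ I₂ x t)) := by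
    rw [hess_slice_snd hφ.contMDiff, mfderiv_slice_snd hφ.contMDiff, h1]
    nth_rw 1 [← dinl_add_dinr t]
    rw [map_add]
    exact add_sub_cancel_right _ _
  rw [secondFundamentalForm_eq (contMDiff_slice_snd hφ.contMDiff x.1), normalPart_eq_sub, h4,
    eq_neg_of_add_eq_zero_left h3, map_neg, map_smul, mfderiv_slice_snd hφ.contMDiff,
    mfderiv_slice_snd hφ.contMDiff]
  · refine (smul_neg _ _).symm.trans ?_
    exact congrArg (· • (-mfderiv (I₁.prod I₂) I φ x (gradLog I₁ I₂ f x) : TangentSpace I (φ x)))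
      (hφ.inner_mfderiv x _ _).symm
  · intro u
    rw [h4, mfderiv_slice_snd hφ.contMDiff]
    exact (hφ.inner_mfderiv x _ _).trans (hM.inner_fst_snd (dsnd_dinl x _) (dfst_dinr x _))

end MainResult

end WarpedSemiSlant

end

open WarpedSemiSlant in
theorem theorem4p1
    -- the Riemannian manifold `N_T`
    {E₁ : Type*} [NormedAddCommGroup E₁] [NormedSpace ℝ E₁] [FiniteDimensional ℝ E₁]
    {NT : Type*} [TopologicalSpace NT] [ChartedSpace E₁ NT] [IsManifold 𝓘(ℝ, E₁) ∞ NT]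
    [RiemannianBundle (fun p : NT ↦ TangentSpace 𝓘(ℝ, E₁) p)]
    [IsContMDiffRiemannianBundle 𝓘(ℝ, E₁) ∞ E₁ (fun p : NT ↦ TangentSpace 𝓘(ℝ, E₁) p)]
    -- the Riemannian manifold `N_θ`
    {E₂ : Type*} [NormedAddCommGroup E₂] [NormedSpace ℝ E₂] [FiniteDimensional ℝ E₂]
    {Nθ : Type*} [TopologicalSpace Nθ] [ChartedSpace E₂ Nθ] [IsManifold 𝓘(ℝ, E₂) ∞ Nθ]
    [RiemannianBundle (fun q : Nθ ↦ TangentSpace 𝓘(ℝ, E₂) q)]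
    [IsContMDiffRiemannianBundle 𝓘(ℝ, E₂) ∞ E₂ (fun q : Nθ ↦ TangentSpace 𝓘(ℝ, E₂) q)]
    -- the warped product `M = N_T ×_f N_θ`
    [RiemannianBundle
      (fun x : NT × Nθ ↦ TangentSpace (𝓘(ℝ, E₁).prod 𝓘(ℝ, E₂)) x)]
    (f : NT → ℝ)
    (hM : IsWarpedProduct 𝓘(ℝ, E₁) 𝓘(ℝ, E₂) (N₁ := NT) (N₂ := Nθ) f)
    -- the nearly Kaehler manifold `N`
    {E : Type*} [NormedAddCommGroup E] [NormedSpace ℝ E] [FiniteDimensional ℝ E]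
    {N : Type*} [TopologicalSpace N] [ChartedSpace E N] [IsManifold 𝓘(ℝ, E) ∞ N]
    [RiemannianBundle (fun y : N ↦ TangentSpace 𝓘(ℝ, E) y)]
    [IsContMDiffRiemannianBundle 𝓘(ℝ, E) ∞ E (fun y : N ↦ TangentSpace 𝓘(ℝ, E) y)]
    (J : ∀ y : N, TangentSpace 𝓘(ℝ, E) y →L[ℝ] TangentSpace 𝓘(ℝ, E) y)
    (hJ : IsNearlyKaehler J)
    -- `M` is a submanifold of `N`, with `N_T` holomorphic and `N_θ` proper slant
    (φ : NT × Nθ → N)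
    (hφ : IsIsometricImmersion (𝓘(ℝ, E₁).prod 𝓘(ℝ, E₂)) 𝓘(ℝ, E) φ)
    (hT : ∀ q : Nθ, IsHolomorphic 𝓘(ℝ, E₁) 𝓘(ℝ, E) J (fun p : NT ↦ φ (p, q)))
    (θ : ℝ)
    (hθ : ∀ p : NT, IsProperSlant 𝓘(ℝ, E₂) 𝓘(ℝ, E) J (fun q : Nθ ↦ φ (p, q)) θ)
    (β : ℕ) (hβ : Module.finrank ℝ E₂ = 2 * β) :
    (∀ x : NT × Nθ,
      sqNormSecondFundamentalForm (𝓘(ℝ, E₁).prod 𝓘(ℝ, E₂)) 𝓘(ℝ, E) φ x ≥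
        4 * (β : ℝ) * ((1 / Real.sin θ) ^ 2 + (1 / 9) * Real.cot θ ^ 2) *
          ‖grad (𝓘(ℝ, E₁).prod 𝓘(ℝ, E₂)) (fun x : NT × Nθ ↦ Real.log (f x.1)) x‖ ^ 2) ∧
    ((∀ x : NT × Nθ,
      sqNormSecondFundamentalForm (𝓘(ℝ, E₁).prod 𝓘(ℝ, E₂)) 𝓘(ℝ, E) φ x =
        4 * (β : ℝ) * ((1 / Real.sin θ) ^ 2 + (1 / 9) * Real.cot θ ^ 2) *
          ‖grad (𝓘(ℝ, E₁).prod 𝓘(ℝ, E₂)) (fun x : NT × Nθ ↦ Real.log (f x.1)) x‖ ^ 2) →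
      (∀ q : Nθ, IsTotallyGeodesic 𝓘(ℝ, E₁) 𝓘(ℝ, E) (fun p : NT ↦ φ (p, q))) ∧
      (∀ p : NT, IsTotallyUmbilical 𝓘(ℝ, E₂) 𝓘(ℝ, E) (fun q : Nθ ↦ φ (p, q))) ∧
      IsMinimal (𝓘(ℝ, E₁).prod 𝓘(ℝ, E₂)) 𝓘(ℝ, E) φ) := by
  have hC : Module.finrank ℝ E₂ = (2 * β : ℝ) := by rw [hβ]; push_cast; ring
  have hcoef : ∀ x : NT × Nθ,
      4 * (β : ℝ) * ((1 / Real.sin θ) ^ 2 + (1 / 9) * Real.cot θ ^ 2) *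
        ‖grad (𝓘(ℝ, E₁).prod 𝓘(ℝ, E₂)) (fun x : NT × Nθ ↦ Real.log (f x.1)) x‖ ^ 2 =
      2 * Module.finrank ℝ (LinearMap.ker (dsnd 𝓘(ℝ, E₁) 𝓘(ℝ, E₂) x).toLinearMap)ᗮ *
        ((1 / Real.sin θ) ^ 2 + 1 / 9 * (Real.cos θ / Real.sin θ) ^ 2) *
        ‖gradLog 𝓘(ℝ, E₁) 𝓘(ℝ, E₂) f x‖ ^ 2 := by
    intro x
    rw [finrank_orthogonal_ker_dsnd, hC, Real.cot_eq_cos_div_sin]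
    ring
  refine ⟨fun x ↦ ?_, fun heq ↦ ?_⟩
  · obtain ⟨P, hP⟩ := exists_semiSlantData hM hJ hφ hT hθ x
    obtain ⟨e, he, -⟩ := sqNorm_eq_sum_sffMap hφ x
    rw [he, hcoef]
    exact hP.le_sum e
  have hzero : ∀ x : NT × Nθ,
      ((∀ X Y : TangentSpace (𝓘(ℝ, E₁).prod 𝓘(ℝ, E₂)) x, dsnd 𝓘(ℝ, E₁) 𝓘(ℝ, E₂) x X = 0 →
        dsnd 𝓘(ℝ, E₁) 𝓘(ℝ, E₂) x Y = 0 → sffMap 𝓘(ℝ, E₁) 𝓘(ℝ, E₂) 𝓘(ℝ, E) φ x X Y = 0) ∧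
      (∀ Z W : TangentSpace (𝓘(ℝ, E₁).prod 𝓘(ℝ, E₂)) x, dfst 𝓘(ℝ, E₁) 𝓘(ℝ, E₂) x Z = 0 →
        dfst 𝓘(ℝ, E₁) 𝓘(ℝ, E₂) x W = 0 → sffMap 𝓘(ℝ, E₁) 𝓘(ℝ, E₂) 𝓘(ℝ, E) φ x Z W = 0)) ∧
      meanCurvature (𝓘(ℝ, E₁).prod 𝓘(ℝ, E₂)) 𝓘(ℝ, E) φ x = 0 := by
    intro x
    obtain ⟨P, hP⟩ := exists_semiSlantData hM hJ hφ hT hθ x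
    obtain ⟨e, he, hm⟩ := sqNorm_eq_sum_sffMap hφ x
    have h := heq x
    rw [he, hcoef] at h
    obtain ⟨h1, h2⟩ := hP.eq_zero_of_sum_eq e h
    refine ⟨⟨fun X Y hX hY ↦ h1 X hX Y hY, fun Z W hZ hW ↦ ?_⟩, ?_⟩
    · exact h2 Z ((mem_orthogonal_ker_dsnd hM).2 hZ) W ((mem_orthogonal_ker_dsnd hM).2 hW)
    · rw [hm, hP.trace_eq_zero_of_sum_eq e h, smul_zero]
  refine ⟨fun q p X Y ↦ ?_, fun p q ↦ ?_, fun x ↦ (hzero x).2⟩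
  · exact secondFundamentalForm_slice_fst hM hφ (p, q) (hzero (p, q)).1.1 X Y
  · exact eq_inner_smul_meanCurvature
      (secondFundamentalForm_slice_snd hM hφ (p, q) (hzero (p, q)).1.2)
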